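/- Let $1\le q\le m$. For a probability measure $Q$ on $\mathbb R^q$ and $y\in\mathbb R^q$ let $d_H(y,Q)=\inf_{\|u\|=1}Q\{z:\langle u,z\rangle\le\langle u,y\rangle\}$ be the halfspace depth and $d_\Delta(y,Q)=\Pr\big(y\in\operatorname{conv}\{Y_1,\dots,Y_{q+1}\}\big)$, with $Y_1,\dots,Y_{q+1}$ i.i.d. with law $Q$, the simplicial depth, and for $L\in\{H,\Delta\}$ let $\sigma_L(Q)=\int_{\mathbb R^q}d_L(y,Q)\,dy\in[0,\infty]$. Let $\mathcal B^{q\times m}$ be the set of real $q\times m$ matrices $B$ with $BB^\top=I_q$; for a measure $P$ on $\mathbb R^m$ let $P_B$ be its image under $x\mapsto Bx$. A matrix $B\in\mathcal B^{q\times m}$ stands for the $q$-dimensional subspace spanned by its rows, that is, for the orthogonal projection $B^\top B$; two matrices with the same projection differ by an orthogonal change of basis and have the same dispersion $\sigma_L(P_B)$. Let $P$ be a probability measure on $\mathbb R^m$ that is absolutely continuous with respect to Lebesgue measure and satisfies $\int\|x\|^\alpha\,dP(x)<\infty$ for some $\alpha>1$. Let $X_1,X_2,\dots$ be i.i.d.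 with law $P$ and let $\hat P_n=\frac1n\sum_{i=1}^n\delta_{X_i}$, $n\ge1$. Let $L\in\{H,\Delta\}$, and let $B^*\in\mathcal B^{q\times m}$ be the unique maximizer (resp. minimizer) of $B\mapsto\sigma_L(P_B)$ up to change of orthonormal basis: $\sigma_L(P_B)<\sigma_L(P_{B^*})$ (resp. $\sigma_L(P_B)>\sigma_L(P_{B^*})$) for every $B\in\mathcal B^{q\times m}$ with $B^\top B\ne (B^*)^\top B^*$. Suppose that, almost surely, for every $n\ge1$ the (random) matrix $\hat B^n\in\mathcal B^{q\times m}$ satisfies $$\sigma_L\big((\hat P_n)_{\hat B^n}\big)=\max_{B\in\mathcal B^{q\times m}}\sigma_L\big((\hat P_n)_B\big)\qquad\Big(\text{resp. }=\min_{B\in\mathcal B^{q\times m}}\sigma_L\big((\hat P_n)_B\big)\Big).$$ Then, almost surely, $\hat B^n\to B^*$ as subspaces: $(\hat B^n)^\top\hat B^n\to (B^*)^\top B^*$ as $n\to\infty$, and there are orthogonal $q\times q$ matrices $U_n$ with $U_n\hat B^n\to B^*$. -/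

import Mathlib

open MeasureTheory ProbabilityTheory Filter Topology
open scoped ENNReal

noncomputable section

namespace DepthDispersion

/-- The closed halfspace with boundary point `x` and outer normal `u`. -/
def halfspace {k : ℕ} (x u : EuclideanSpace ℝ (Fin k)) : Set (EuclideanSpace ℝ (Fin k)) :=
  {y | inner ℝ u y ≤ inner ℝ u x}

/-- Halfspace (Tukey) depth of `x` with respect to `P`: the infimum over unit vectors `u` of the
mass of the closed halfspace with boundary point `x` and outer normal `u`. -/
def halfspaceDepth {k : ℕ} (P : Measure (EuclideanSpace ℝ (Fin k)))
    (x : EuclideanSpace ℝ (Fin k)) : ℝ≥0∞ :=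
  ⨅ u ∈ Metric.sphere (0 : EuclideanSpace ℝ (Fin k)) 1, P (halfspace x u)

/-- Simplicial depth of `x` with respect to `P` on `ℝᵏ`: the probability that `x` lies in the
closed simplex whose `k + 1` vertices are independent with distribution `P`. -/
def simplicialDepth {k : ℕ} (P : Measure (EuclideanSpace ℝ (Fin k)))
    (x : EuclideanSpace ℝ (Fin k)) : ℝ≥0∞ :=
  Measure.pi (fun _ : Fin (k + 1) => P) {v | x ∈ convexHull ℝ (Set.range v)}

/-- The two depths under consideration. -/
inductive DepthKind where
  | halfspace
  | simplicial

/-- The depth of the given kind. -/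
def depth {k : ℕ} : DepthKind → Measure (EuclideanSpace ℝ (Fin k)) →
    EuclideanSpace ℝ (Fin k) → ℝ≥0∞
  | .halfspace => halfspaceDepth
  | .simplicial => simplicialDepth

/-- The dispersion measure: the Lebesgue integral of the depth, with values in `[0, ∞]`. -/
def dispersion {k : ℕ} (L : DepthKind) (P : Measure (EuclideanSpace ℝ (Fin k))) : ℝ≥0∞ :=
  ∫⁻ x, depth L P x

/-- The `q × m` matrices with orthonormal rows. -/
def frames (q m : ℕ) : Set (Matrix (Fin q) (Fin m) ℝ) :=
  {B | B * B.transpose = 1}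

/-- The image `A ↦ P (B⁻¹ A)` on `ℝ^q` of a measure `P` on `ℝᵐ` under `x ↦ B x`. -/
def projMeasure {q m : ℕ} (P : Measure (EuclideanSpace ℝ (Fin m)))
    (B : Matrix (Fin q) (Fin m) ℝ) : Measure (EuclideanSpace ℝ (Fin q)) :=
  P.map (fun x => Matrix.toEuclideanLin B x)

/-- The empirical measure of the first `n` points of a sequence (used for `n ≥ 1`). -/
def empirical {m : ℕ} (x : ℕ → EuclideanSpace ℝ (Fin m)) (n : ℕ) :
    Measure (EuclideanSpace ℝ (Fin m)) :=
  (n : ℝ≥0∞)⁻¹ • ∑ i ∈ Finset.range n, Measure.dirac (x i)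

/-- The matrix of the orthogonal projection of `ℝᵐ` onto the row space of `B` (for `B` with
orthonormal rows). Two matrices with orthonormal rows have the same row space if and only if these
projections agree. -/
def rowProj {q m : ℕ} (B : Matrix (Fin q) (Fin m) ℝ) : Matrix (Fin m) (Fin m) ℝ :=
  B.transpose * B

/-- `B` maximizes `φ` over the matrices with orthonormal rows. -/
def IsMaximizer {q m : ℕ} (φ : Matrix (Fin q) (Fin m) ℝ → ℝ≥0∞)
    (B : Matrix (Fin q) (Fin m) ℝ) : Prop :=
  B ∈ frames q m ∧ ∀ C ∈ frames q m, φ C ≤ φ B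

/-- `B` minimizes `φ` over the matrices with orthonormal rows. -/
def IsMinimizer {q m : ℕ} (φ : Matrix (Fin q) (Fin m) ℝ → ℝ≥0∞)
    (B : Matrix (Fin q) (Fin m) ℝ) : Prop :=
  B ∈ frames q m ∧ ∀ C ∈ frames q m, φ B ≤ φ C

/-- `B` is the unique maximizer of `φ`, matrices being identified when they are orthonormal
bases of the same subspace. -/
def IsUniqueMaximizer {q m : ℕ} (φ : Matrix (Fin q) (Fin m) ℝ → ℝ≥0∞)
    (B : Matrix (Fin q) (Fin m) ℝ) : Prop :=
  B ∈ frames q m ∧ ∀ C ∈ frames q m, rowProj C ≠ rowProj B → φ C < φ B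

/-- `B` is the unique minimizer of `φ`, matrices being identified when they are orthonormal
bases of the same subspace. -/
def IsUniqueMinimizer {q m : ℕ} (φ : Matrix (Fin q) (Fin m) ℝ → ℝ≥0∞)
    (B : Matrix (Fin q) (Fin m) ℝ) : Prop :=
  B ∈ frames q m ∧ ∀ C ∈ frames q m, rowProj C ≠ rowProj B → φ B < φ C

/-- Convergence of `Bs n` to `B` as representatives of subspaces: the orthogonal projections onto
the row spaces converge, and the matrices themselves converge after a suitable orthogonal change of
basis in each row space. The topology on matrices is that of any norm. -/
def SubspaceTendsto {q m : ℕ} (Bs : ℕ → Matrix (Fin q) (Fin m) ℝ)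
    (B : Matrix (Fin q) (Fin m) ℝ) : Prop :=
  Tendsto (fun n => rowProj (Bs n)) atTop (𝓝 (rowProj B)) ∧
    ∃ U : ℕ → Matrix (Fin q) (Fin q) ℝ,
      (∀ n, U n ∈ Matrix.orthogonalGroup (Fin q) ℝ) ∧
      Tendsto (fun n => U n * Bs n) atTop (𝓝 B)

end DepthDispersion

end

/-!
The function `B ↦ σ(P_B)` lives on the compact set of frames, so it suffices to show that every
limit point `C` of the optimizers has the row space of `B*`. For maximizers this follows once
`σ(P_{B*}) ≤ liminf σ((P̂ₙ)_{B*})` and `limsup σ((P̂ₙ)_{Bₙ}) ≤ σ(P_C)` whenever `Bₙ → C`; for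
minimizers the two inequalities exchange their places (`subspaceTendsto_of_isMaximizer`,
`subspaceTendsto_of_isMinimizer`). Almost surely the empirical measures converge weakly to `P`
(`ae_tendsto_empiricalProb`), and from there on the two depths need different arguments.

Simplicial depth. By Tonelli, `σ(Q)` is the mean volume of a random simplex, and this volume is a
constant times a determinant that is affine in each of the `q + 1` independent vertices. Hence the
moments of order `α > 1` of `P̂ₙ`, bounded by the strong law, make the volumes uniformly
integrable, and `σ` is continuous along `((P̂ₙ)_{Bₙ})` (`tendsto_dispersion_simplicial`).

Halfspace depth. The depth at a fixed point is continuous under weak convergence, since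
hyperplanes are null for `P` (`tendsto_halfspaceDepth`), and Fatou's lemma gives the lower bounds.
If `q ≥ 2`, then moments of order `α > 1` do not bound the dispersion, which may even be infinite,
so the upper bounds come from elsewhere.

* For one fixed projection with `σ(P_B) < ∞` the strong law holds
  (`ae_tendsto_dispersion_halfspace`): the depth at `y` is at most the mass of a halfspace chosen
  almost optimally for `P`, and after integration over `y` this is a linear functional of the
  measure. This settles the minimizers, as a unique minimum over more than one subspace is finite.
* For maximizers, a bound uniform in `B` is needed. A centerpoint argument, based on Helly's
  theorem, shows that a depth region of the projection `Q_B` lies in the projection of the depth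
  region of `Q` at a level smaller by the factor `m + 1`
  (`le_halfspaceDepth_projMeasure_subset_image`). The volume of a projection of a convex body is
  controlled by its projections to the coordinate planes of any orthonormal basis, via a largest
  inscribed simplex and the expansion of a determinant (`exists_volume_image_le`). Together, the
  truncated integral `∫ min(d, ε)` for any `B` is bounded by the truncated integrals for finitely
  many fixed coordinate planes (`exists_lintegral_min_halfspaceDepth_le`). Choosing the basis so
  that none of these planes is the row space of `B*`, their dispersions are less than the maximum,
  hence finite, and the law of large numbers for fixed projections applies to them. The remaining
  part `(d - ε)⁺` is supported in a common ball by tightness (`limsup_dispersion_halfspace_le`).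
-/

open MeasureTheory ProbabilityTheory Filter Topology
open scoped ENNReal

noncomputable section

namespace DepthDispersion

/-! ### Matrices with orthonormal rows -/

section Frames

variable {q m : ℕ}

instance : FirstCountableTopology (Matrix (Fin q) (Fin m) ℝ) :=
  inferInstanceAs (FirstCountableTopology (Fin q → Fin m → ℝ))

lemma isClosed_frames : IsClosed (frames q m) :=
  isClosed_eq (by fun_prop) continuous_const

lemma sum_sq_row_of_mem_frames {B : Matrix (Fin q) (Fin m) ℝ} (hB : B ∈ frames q m) (i : Fin q) :
    ∑ j, B i j ^ 2 = 1 := by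
  have h : (B * B.transpose) i i = 1 := by rw [show B * B.transpose = 1 from hB]; simp
  simpa [Matrix.mul_apply, pow_two] using h

lemma abs_le_one_of_mem_frames {B : Matrix (Fin q) (Fin m) ℝ} (hB : B ∈ frames q m)
    (i : Fin q) (j : Fin m) : |B i j| ≤ 1 := by
  rw [← sq_le_one_iff_abs_le_one, ← sum_sq_row_of_mem_frames hB i]
  exact Finset.single_le_sum (f := fun j => B i j ^ 2) (fun _ _ => sq_nonneg _)
    (Finset.mem_univ j)

lemma isCompact_frames : IsCompact (frames q m) := by
  refine IsCompact.of_isClosed_subset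
    (isCompact_univ_pi fun _ : Fin q => isCompact_univ_pi fun _ : Fin m =>
      isCompact_Icc (a := (-1 : ℝ)) (b := 1)) isClosed_frames ?_
  intro B hB i _ j _
  exact abs_le.1 (abs_le_one_of_mem_frames hB i j)

lemma continuous_toEuclideanLin_apply :
    Continuous fun p : Matrix (Fin q) (Fin m) ℝ × EuclideanSpace ℝ (Fin m) =>
      Matrix.toEuclideanLin p.1 p.2 := by
  simp only [Matrix.toLpLin_apply]
  fun_prop

lemma inner_toEuclideanLin (B : Matrix (Fin q) (Fin m) ℝ) (u : EuclideanSpace ℝ (Fin q))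
    (x : EuclideanSpace ℝ (Fin m)) :
    inner ℝ u (Matrix.toEuclideanLin B x) =
      inner ℝ (Matrix.toEuclideanLin B.transpose u) x := by
  simp only [Matrix.toLpLin_apply, EuclideanSpace.inner_eq_star_dotProduct, star_trivial]
  rw [Matrix.mulVec_transpose, dotProduct_comm, Matrix.dotProduct_mulVec, dotProduct_comm]

lemma toEuclideanLin_transpose_apply {B : Matrix (Fin q) (Fin m) ℝ} (hB : B ∈ frames q m)
    (u : EuclideanSpace ℝ (Fin q)) :
    Matrix.toEuclideanLin B (Matrix.toEuclideanLin B.transpose u) = u := by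
  simp only [Matrix.toLpLin_apply, Matrix.mulVec_mulVec]
  rw [show B * B.transpose = 1 from hB]
  simp

lemma norm_toEuclideanLin_transpose {B : Matrix (Fin q) (Fin m) ℝ} (hB : B ∈ frames q m)
    (u : EuclideanSpace ℝ (Fin q)) : ‖Matrix.toEuclideanLin B.transpose u‖ = ‖u‖ := by
  rw [← sq_eq_sq₀ (norm_nonneg _) (norm_nonneg _), ← real_inner_self_eq_norm_sq,
    ← real_inner_self_eq_norm_sq, ← inner_toEuclideanLin, toEuclideanLin_transpose_apply hB]

lemma norm_toEuclideanLin_le {B : Matrix (Fin q) (Fin m) ℝ} (hB : B ∈ frames q m)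
    (x : EuclideanSpace ℝ (Fin m)) : ‖Matrix.toEuclideanLin B x‖ ≤ ‖x‖ := by
  set y := Matrix.toEuclideanLin B x
  have h : ‖y‖ * ‖y‖ ≤ ‖y‖ * ‖x‖ := by
    calc ‖y‖ * ‖y‖ = inner ℝ y y := (real_inner_self_eq_norm_mul_norm y).symm
      _ = inner ℝ (Matrix.toEuclideanLin B.transpose y) x := inner_toEuclideanLin B y x
      _ ≤ ‖Matrix.toEuclideanLin B.transpose y‖ * ‖x‖ := real_inner_le_norm _ _
      _ = ‖y‖ * ‖x‖ := by rw [norm_toEuclideanLin_transpose hB]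
  rcases (norm_nonneg y).eq_or_lt with h0 | h0
  · rw [← h0]; exact norm_nonneg _
  · exact le_of_mul_le_mul_left h h0

/-- The change of basis `B * Cᵀ` between two orthonormal bases of the same subspace is
orthogonal. -/
lemma mem_orthogonalGroup_of_rowProj_eq {B C : Matrix (Fin q) (Fin m) ℝ} (hB : B ∈ frames q m)
    (h : rowProj C = rowProj B) :
    B * C.transpose ∈ Matrix.orthogonalGroup (Fin q) ℝ ∧
      B * C.transpose * C = B := by
  have hB' : B * B.transpose = 1 := hB
  have h' : C.transpose * C = B.transpose * B := h
  refine ⟨?_, ?_⟩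
  · rw [Matrix.mem_orthogonalGroup_iff, Matrix.transpose_mul,
      Matrix.transpose_transpose, Matrix.mul_assoc, ← Matrix.mul_assoc C.transpose, h',
      Matrix.mul_assoc B.transpose, hB', Matrix.mul_one, hB']
  · rw [Matrix.mul_assoc, h', ← Matrix.mul_assoc, hB', Matrix.one_mul]

/-- A sequence of frames all of whose limit points span the row space of `B` converges to `B` as a
sequence of subspaces. The change of basis minimizes the distance of `U * Bs n` to `B`. -/
lemma subspaceTendsto_of_forall_limit {Bs : ℕ → Matrix (Fin q) (Fin m) ℝ}
    {B : Matrix (Fin q) (Fin m) ℝ} (hB : B ∈ frames q m) (hBs : ∀ n ≥ 1, Bs n ∈ frames q m)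
    (h : ∀ ψ : ℕ → ℕ, Tendsto ψ atTop atTop → ∀ C ∈ frames q m,
      Tendsto (fun k => Bs (ψ k + 1)) atTop (𝓝 C) → rowProj C = rowProj B) :
    SubspaceTendsto Bs B := by
  -- every subsequence has a further subsequence along which `Bs` converges to some frame
  have key : ∀ ns : ℕ → ℕ, Tendsto ns atTop atTop → ∃ ms : ℕ → ℕ, ∃ C ∈ frames q m,
      Tendsto ms atTop atTop ∧
      Tendsto (fun k => Bs (ns (ms k))) atTop (𝓝 C) ∧ rowProj C = rowProj B := by
    intro ns hns
    obtain ⟨N, hN⟩ := eventually_atTop.1 (hns.eventually_ge_atTop 1)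
    obtain ⟨C, hC, φ, hφ, hlim⟩ := isCompact_frames.tendsto_subseq
      (x := fun k => Bs (ns (k + N))) (fun k => hBs _ (hN _ (by omega)))
    have hm : Tendsto (fun k => φ k + N) atTop atTop :=
      tendsto_atTop_mono (fun k => Nat.le_add_right _ _) hφ.tendsto_atTop
    refine ⟨fun k => φ k + N, C, hC, hm, hlim,
      h (fun k => ns (φ k + N) - 1) ((tendsto_sub_atTop_nat 1).comp (hns.comp hm)) C hC ?_⟩
    have hshift : ∀ k, ns (φ k + N) - 1 + 1 = ns (φ k + N) := fun k =>
      Nat.sub_add_cancel (hN _ (by omega))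
    simpa only [hshift] using! hlim
  refine ⟨?_, ?_⟩
  · refine tendsto_of_subseq_tendsto fun ns hns => ?_
    obtain ⟨ms, C, -, -, hlim, hCB⟩ := key ns hns
    refine ⟨ms, ?_⟩
    rw [← hCB]
    have hc : Continuous fun A : Matrix (Fin q) (Fin m) ℝ => rowProj A := by
      unfold rowProj; fun_prop
    exact (hc.tendsto C).comp hlim
  · set D : Matrix (Fin q) (Fin q) ℝ → Matrix (Fin q) (Fin m) ℝ → ℝ :=
      fun U A => ∑ i, ∑ j, ((U * A) i j - B i j) ^ 2 with hD
    have hDc : Continuous fun p : Matrix (Fin q) (Fin q) ℝ × Matrix (Fin q) (Fin m) ℝ =>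
        D p.1 p.2 := by
      refine continuous_finsetSum _ fun i _ => continuous_finsetSum _ fun j _ => ?_
      have : Continuous fun p : Matrix (Fin q) (Fin q) ℝ × Matrix (Fin q) (Fin m) ℝ =>
        (p.1 * p.2) i j := (by fun_prop : Continuous fun p : Matrix (Fin q) (Fin q) ℝ ×
          Matrix (Fin q) (Fin m) ℝ => p.1 * p.2).matrix_elem i j
      fun_prop
    have horth : ∀ U : Matrix (Fin q) (Fin q) ℝ,
        U ∈ frames q q ↔ U ∈ Matrix.orthogonalGroup (Fin q) ℝ := fun U => by
      rw [Matrix.mem_orthogonalGroup_iff]; rfl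
    have hmin : ∀ n, ∃ U ∈ frames q q, ∀ V ∈ frames q q, D U (Bs n) ≤ D V (Bs n) := fun n => by
      obtain ⟨U, hU, hU'⟩ := (isCompact_frames (q := q) (m := q)).exists_isMinOn
        ⟨1, by simp [frames]⟩ (f := fun U => D U (Bs n))
        (hDc.comp (by fun_prop : Continuous fun U => (U, Bs n))).continuousOn
      exact ⟨U, hU, hU'⟩
    choose U hU hUmin using hmin
    refine ⟨U, fun n => (horth _).1 (hU n), ?_⟩
    have hto0 : Tendsto (fun n => D (U n) (Bs n)) atTop (𝓝 0) := by
      refine tendsto_of_subseq_tendsto fun ns hns => ?_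
      obtain ⟨ms, C, -, -, hlim, hCB⟩ := key ns hns
      refine ⟨ms, ?_⟩
      obtain ⟨h1, h2⟩ := mem_orthogonalGroup_of_rowProj_eq hB hCB
      have hlim' : Tendsto (fun k => D (B * C.transpose) (Bs (ns (ms k)))) atTop (𝓝 0) := by
        have : D (B * C.transpose) C = 0 := by simp [hD, h2]
        rw [← this]
        exact ((hDc.comp (by fun_prop : Continuous fun A => (B * C.transpose, A))).tendsto C).comp
          hlim
      exact squeeze_zero
        (fun k => Finset.sum_nonneg fun i _ => Finset.sum_nonneg fun j _ => sq_nonneg _)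
        (fun k => hUmin _ _ ((horth _).2 h1)) hlim'
    refine tendsto_pi_nhds.2 fun i => tendsto_pi_nhds.2 fun j => ?_
    have hsq : Tendsto (fun n => ((U n * Bs n) i j - B i j) ^ 2) atTop (𝓝 0) := by
      refine squeeze_zero (fun n => sq_nonneg _) (fun n => ?_) hto0
      exact (Finset.single_le_sum (f := fun j => ((U n * Bs n) i j - B i j) ^ 2)
        (fun _ _ => sq_nonneg _) (Finset.mem_univ j)).trans
        (Finset.single_le_sum (f := fun i => ∑ j, ((U n * Bs n) i j - B i j) ^ 2)
        (fun _ _ => Finset.sum_nonneg fun _ _ => sq_nonneg _) (Finset.mem_univ i))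
    have habs : Tendsto (fun n => |(U n * Bs n) i j - B i j|) atTop (𝓝 0) := by
      have := (Real.continuous_sqrt.tendsto 0).comp hsq
      simpa [Function.comp_def, Real.sqrt_sq_eq_abs] using this
    have := (tendsto_zero_iff_abs_tendsto_zero _).2 habs
    simpa using this.add_const (B i j)

end Frames

/-! ### Empirical measures -/

section Empirical

variable {Ω : Type*} [MeasurableSpace Ω] {μ : Measure Ω} {m : ℕ}
  {P : Measure (EuclideanSpace ℝ (Fin m))} {X : ℕ → Ω → EuclideanSpace ℝ (Fin m)}

lemma lintegral_empirical (x : ℕ → EuclideanSpace ℝ (Fin m)) (n : ℕ)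
    {f : EuclideanSpace ℝ (Fin m) → ℝ≥0∞} (hf : Measurable f) :
    ∫⁻ y, f y ∂empirical x n = (n : ℝ≥0∞)⁻¹ * ∑ i ∈ Finset.range n, f (x i) := by
  rw [empirical, lintegral_smul_measure, lintegral_finsetSum_measure]
  simp [lintegral_dirac' _ hf]

lemma isProbabilityMeasure_empirical (x : ℕ → EuclideanSpace ℝ (Fin m)) {n : ℕ} (hn : n ≠ 0) :
    IsProbabilityMeasure (empirical x n) := by
  constructor
  have := lintegral_empirical x n (f := 1) measurable_one
  simp only [Pi.one_apply, lintegral_one, Finset.sum_const, Finset.card_range, nsmul_eq_mul,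
    mul_one] at this
  rw [this, ENNReal.inv_mul_cancel (by simpa using hn) (ENNReal.natCast_ne_top n)]

/-- The empirical measure of the first `n + 1` points. -/
def empiricalProb (x : ℕ → EuclideanSpace ℝ (Fin m)) (n : ℕ) :
    ProbabilityMeasure (EuclideanSpace ℝ (Fin m)) :=
  ⟨empirical x (n + 1), isProbabilityMeasure_empirical x n.succ_ne_zero⟩

/-- The strong law of large numbers for extended nonnegative test functions. -/
lemma ae_tendsto_lintegral_empirical (hlaw : ∀ i, HasLaw (X i) P μ) (hind : iIndepFun X μ)
    {f : EuclideanSpace ℝ (Fin m) → ℝ≥0∞} (hf : Measurable f) (hfi : ∫⁻ x, f x ∂P ≠ ∞) :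
    ∀ᵐ ω ∂μ, Tendsto (fun n => ∫⁻ x, f x ∂(empiricalProb (fun i => X i ω) n).toMeasure) atTop
      (𝓝 (∫⁻ x, f x ∂P)) := by
  have hfin : ∀ᵐ x ∂P, f x < ∞ := ae_lt_top hf hfi
  have hfinX : ∀ᵐ ω ∂μ, ∀ i, f (X i ω) < ∞ := by
    rw [ae_all_iff]
    intro i
    have := hfin
    rw [← (hlaw i).map_eq] at this
    exact ae_of_ae_map (hlaw i).aemeasurable this
  have hg : Measurable fun x => (f x).toReal := hf.ennreal_toReal
  have hint : Integrable (fun x => (f x).toReal) P := integrable_toReal_of_lintegral_ne_top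
    hf.aemeasurable hfi
  have hlaw' : ∀ i, HasLaw (fun ω => (f (X i ω)).toReal) (P.map fun x => (f x).toReal) μ :=
    fun i => HasLaw.comp (Y := fun x => (f x).toReal) ⟨hg.aemeasurable, rfl⟩ (hlaw i)
  have hslln := strong_law_ae_real (μ := μ) (fun i ω => (f (X i ω)).toReal)
    (by
      have h0 := (hlaw 0).map_eq
      rw [← h0] at hint
      exact hint.comp_aemeasurable (hlaw 0).aemeasurable)
    (fun i j hij => (hind.indepFun hij).comp hg hg)
    (fun i => ⟨(hlaw' i).aemeasurable, (hlaw' 0).aemeasurable,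
      (hlaw' i).map_eq.trans (hlaw' 0).map_eq.symm⟩)
  have hmean : ∫ ω, (f (X 0 ω)).toReal ∂μ = (∫⁻ x, f x ∂P).toReal := by
    rw [← integral_toReal hf.aemeasurable hfin]
    exact (hlaw 0).integral_comp hg.aestronglyMeasurable
  filter_upwards [hslln, hfinX] with ω h1 h2
  rw [hmean] at h1
  have h3 := ENNReal.tendsto_ofReal ((tendsto_add_atTop_iff_nat 1).2 h1)
  rw [ENNReal.ofReal_toReal hfi] at h3
  refine h3.congr fun n => ?_
  change _ = ∫⁻ x, f x ∂(empirical (fun i => X i ω) (n + 1))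
  rw [lintegral_empirical _ _ hf, ENNReal.ofReal_div_of_pos (by positivity),
    ENNReal.ofReal_sum_of_nonneg (fun _ _ => ENNReal.toReal_nonneg), ENNReal.div_eq_inv_mul]
  congr 1
  · rw [ENNReal.ofReal_natCast]
  · exact Finset.sum_congr rfl fun i _ => ENNReal.ofReal_toReal (h2 i).ne

/-- Almost surely the empirical measures converge weakly to the underlying law. -/
lemma ae_tendsto_empiricalProb [IsProbabilityMeasure P] (hlaw : ∀ i, HasLaw (X i) P μ)
    (hind : iIndepFun X μ) :
    ∀ᵐ ω ∂μ, Tendsto (empiricalProb fun i => X i ω) atTop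
      (𝓝 (⟨P, inferInstance⟩ : ProbabilityMeasure (EuclideanSpace ℝ (Fin m)))) := by
  set b := TopologicalSpace.countableBasis (EuclideanSpace ℝ (Fin m))
  have hb := TopologicalSpace.isBasis_countableBasis (EuclideanSpace ℝ (Fin m))
  set S : Finset b → Set (EuclideanSpace ℝ (Fin m)) := fun t => ⋂ s ∈ t, s.1 with hS
  have hSm : ∀ t, MeasurableSet (S t) := fun t =>
    Finset.measurableSet_biInter _ fun s _ => (hb.isOpen s.2).measurableSet
  have hconv : ∀ᵐ ω ∂μ, ∀ t, Tendsto
      (fun n => (empiricalProb (fun i => X i ω) n).toMeasure (S t)) atTop (𝓝 (P (S t))) := by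
    rw [ae_all_iff]
    intro t
    filter_upwards [ae_tendsto_lintegral_empirical hlaw hind
      (f := (S t).indicator 1) (measurable_one.indicator (hSm t))
      (by rw [lintegral_indicator_one (hSm t)]; exact measure_ne_top _ _)] with ω hω
    simpa only [lintegral_indicator_one (hSm t)] using hω
  filter_upwards [hconv] with ω hω
  refine IsPiSystem.tendsto_probabilityMeasure_of_tendsto_of_mem (S := Set.range S) ?_ ?_ ?_ ?_
  · classical
    rintro _ ⟨t, rfl⟩ _ ⟨t', rfl⟩ -
    refine ⟨t ∪ t', ?_⟩
    simp only [hS]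
    exact Finset.inf_union (s₁ := t) (s₂ := t') (f := fun s => s.1) |> fun h => by
      simpa [Finset.inf_eq_iInf] using h
  · rintro _ ⟨t, rfl⟩; exact hSm t
  · intro u hu x hx
    obtain ⟨s, hs, hxs, hsu⟩ := hb.exists_subset_of_mem_open hx hu
    exact ⟨s, ⟨{⟨s, hs⟩}, by
      simp only [hS, Finset.mem_singleton]
      exact Set.iInter_iInter_eq_left (b := (⟨s, hs⟩ : b)) (s := fun i _ => i.1)⟩,
      (hb.isOpen hs).mem_nhds hxs, hsu⟩
  · rintro _ ⟨t, rfl⟩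
    exact (ENNReal.tendsto_toNNReal (measure_ne_top P _)).comp (hω t)

end Empirical

/-! ### Halfspace depth and weak convergence -/

section HalfspaceDepth

variable {q m k : ℕ}

lemma measurable_toEuclideanLin (B : Matrix (Fin q) (Fin m) ℝ) :
    Measurable fun x => Matrix.toEuclideanLin B x :=
  (continuous_toEuclideanLin_apply.comp
    (by fun_prop : Continuous fun x : EuclideanSpace ℝ (Fin m) => (B, x))).measurable

lemma tendsto_toEuclideanLin {ι : Type*} {l : Filter ι} {A : ι → Matrix (Fin q) (Fin m) ℝ}
    {A₀ : Matrix (Fin q) (Fin m) ℝ} {x : ι → EuclideanSpace ℝ (Fin m)}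
    {x₀ : EuclideanSpace ℝ (Fin m)} (hA : Tendsto A l (𝓝 A₀)) (hx : Tendsto x l (𝓝 x₀)) :
    Tendsto (fun i => Matrix.toEuclideanLin (A i) (x i)) l (𝓝 (Matrix.toEuclideanLin A₀ x₀)) := by
  have h := (continuous_toEuclideanLin_apply (q := q) (m := m)).continuousAt (x := (A₀, x₀))
  have h' := h.tendsto.comp (hA.prodMk_nhds hx)
  exact h'

lemma isClosed_halfspace (x u : EuclideanSpace ℝ (Fin k)) : IsClosed (halfspace x u) :=
  isClosed_le (by fun_prop) continuous_const

lemma isProbabilityMeasure_projMeasure (P : Measure (EuclideanSpace ℝ (Fin m)))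
    [IsProbabilityMeasure P] (B : Matrix (Fin q) (Fin m) ℝ) :
    IsProbabilityMeasure (projMeasure P B) :=
  Measure.isProbabilityMeasure_map (measurable_toEuclideanLin B).aemeasurable

lemma projMeasure_halfspace (P : Measure (EuclideanSpace ℝ (Fin m)))
    (B : Matrix (Fin q) (Fin m) ℝ) (y u : EuclideanSpace ℝ (Fin q)) :
    projMeasure P B (halfspace y u) =
      P {x | inner ℝ (Matrix.toEuclideanLin B.transpose u) x ≤ inner ℝ u y} := by
  rw [projMeasure, Measure.map_apply (measurable_toEuclideanLin B)
    (isClosed_halfspace y u).measurableSet]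
  simp only [halfspace, Set.preimage_ofPred_eq, inner_toEuclideanLin]

lemma volume_hyperplane {a : EuclideanSpace ℝ (Fin k)} (ha : a ≠ 0) (c : ℝ) :
    volume {x | inner ℝ a x = c} = 0 := by
  rcases Set.eq_empty_or_nonempty {x | inner ℝ a x = c} with h | ⟨x₀, hx₀⟩
  · rw [h]; simp
  have hx₀ : inner ℝ a x₀ = c := hx₀
  have h1 : {x | inner ℝ a x = c} = (fun x => x + -x₀) ⁻¹'
      (LinearMap.ker (innerₛₗ ℝ a) : Set (EuclideanSpace ℝ (Fin k))) := by
    ext x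
    simp [inner_add_right, inner_neg_right, hx₀, add_neg_eq_zero]
  rw [h1, measure_preimage_add_right]
  refine Measure.addHaar_submodule _ _ fun htop => ha ?_
  have : a ∈ LinearMap.ker (innerₛₗ ℝ a) := by rw [htop]; trivial
  simpa using this

/-- The law of `⟪a, x⟫ - c`, the signed distance from the boundary of a halfspace, depends
continuously on the underlying law and on the halfspace. -/
lemma tendsto_map_inner_sub {ι : Type*} {l : Filter ι}
    {ν : ι → ProbabilityMeasure (EuclideanSpace ℝ (Fin k))}
    {P : ProbabilityMeasure (EuclideanSpace ℝ (Fin k))} (hν : Tendsto ν l (𝓝 P))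
    {a : ι → EuclideanSpace ℝ (Fin k)} {a₀ : EuclideanSpace ℝ (Fin k)} (ha : Tendsto a l (𝓝 a₀))
    {c : ι → ℝ} {c₀ : ℝ} (hc : Tendsto c l (𝓝 c₀)) :
    Tendsto (fun i => (ν i).map (f := fun x => inner ℝ (a i) x - c i) (by fun_prop)) l
      (𝓝 (P.map (f := fun x => inner ℝ a₀ x - c₀) (by fun_prop))) := by
  have hF : Continuous fun p : (EuclideanSpace ℝ (Fin k) × ℝ) × EuclideanSpace ℝ (Fin k) =>
      inner ℝ p.1.1 p.2 - p.1.2 := by fun_prop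
  have h1 : Tendsto (fun i => (diracProba (a i, c i)).prod (ν i)) l
      (𝓝 ((diracProba (a₀, c₀)).prod P)) :=
    (ProbabilityMeasure.continuous_prod.tendsto _).comp
      (((continuous_diracProba.tendsto _).comp (ha.prodMk_nhds hc)).prodMk_nhds hν)
  have h2 := ProbabilityMeasure.tendsto_map_of_tendsto_of_continuous _ _ h1 hF
  have key : ∀ (a : EuclideanSpace ℝ (Fin k)) (c : ℝ)
      (ν : ProbabilityMeasure (EuclideanSpace ℝ (Fin k))),
      ((diracProba (a, c)).prod ν).map hF.measurable.aemeasurable =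
        ν.map (f := fun x => inner ℝ a x - c) (by fun_prop) := by
    intro a c ν
    apply Subtype.ext
    change Measure.map _ ((Measure.dirac (a, c)).prod ν.toMeasure) = Measure.map _ ν.toMeasure
    rw [Measure.dirac_prod, Measure.map_map hF.measurable (by fun_prop)]
    rfl
  simpa only [key] using h2

lemma map_inner_sub_Iic (P : ProbabilityMeasure (EuclideanSpace ℝ (Fin k)))
    (a : EuclideanSpace ℝ (Fin k)) (c : ℝ) :
    (P.map (f := fun x => inner ℝ a x - c) (by fun_prop)).toMeasure (Set.Iic 0) =
      P.toMeasure {x | inner ℝ a x ≤ c} := by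
  rw [ProbabilityMeasure.toMeasure_map, Measure.map_apply (by fun_prop) measurableSet_Iic]
  simp [Set.preimage]

lemma tendsto_measure_halfspace {ι : Type*} {l : Filter ι}
    {ν : ι → ProbabilityMeasure (EuclideanSpace ℝ (Fin k))}
    {P : ProbabilityMeasure (EuclideanSpace ℝ (Fin k))} (hν : Tendsto ν l (𝓝 P))
    (hP : P.toMeasure ≪ volume)
    {a : ι → EuclideanSpace ℝ (Fin k)} {a₀ : EuclideanSpace ℝ (Fin k)} (ha : Tendsto a l (𝓝 a₀))
    (ha₀ : a₀ ≠ 0) {c : ι → ℝ} {c₀ : ℝ} (hc : Tendsto c l (𝓝 c₀)) :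
    Tendsto (fun i => (ν i).toMeasure {x | inner ℝ (a i) x ≤ c i}) l
      (𝓝 (P.toMeasure {x | inner ℝ a₀ x ≤ c₀})) := by
  have := ProbabilityMeasure.tendsto_measure_of_null_frontier_of_tendsto'
    (tendsto_map_inner_sub hν ha hc) (E := Set.Iic 0) (by
      rw [frontier_Iic, ProbabilityMeasure.toMeasure_map,
        Measure.map_apply (by fun_prop) (measurableSet_singleton _)]
      refine hP ?_
      simpa [Set.preimage, sub_eq_zero] using volume_hyperplane ha₀ c₀)
  simpa only [map_inner_sub_Iic] using this

lemma limsup_measure_halfspace_le {ι : Type*} {l : Filter ι}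
    (P : ProbabilityMeasure (EuclideanSpace ℝ (Fin k)))
    (a : EuclideanSpace ℝ (Fin k)) {c : ι → ℝ} {c₀ : ℝ} (hc : Tendsto c l (𝓝 c₀)) :
    l.limsup (fun i => P.toMeasure {x | inner ℝ a x ≤ c i}) ≤
      P.toMeasure {x | inner ℝ a x ≤ c₀} := by
  have := ProbabilityMeasure.limsup_measure_closed_le_of_tendsto
    (tendsto_map_inner_sub (tendsto_const_nhds (x := P)) (tendsto_const_nhds (x := a)) hc)
    (isClosed_Iic (a := (0 : ℝ)))
  simpa only [map_inner_sub_Iic] using this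

lemma le_halfspaceDepth_iff {Q : Measure (EuclideanSpace ℝ (Fin k))} {t : ℝ≥0∞}
    {y : EuclideanSpace ℝ (Fin k)} :
    t ≤ halfspaceDepth Q y ↔ ∀ u : EuclideanSpace ℝ (Fin k), ‖u‖ = 1 → t ≤ Q (halfspace y u) := by
  simp [halfspaceDepth, le_iInf_iff]

/-- Halfspace depth is jointly continuous in the law and the projection, at an absolutely
continuous law. -/
lemma tendsto_halfspaceDepth {ι : Type*} {l : Filter ι}
    {ν : ι → ProbabilityMeasure (EuclideanSpace ℝ (Fin m))}
    {P : ProbabilityMeasure (EuclideanSpace ℝ (Fin m))} (hν : Tendsto ν l (𝓝 P))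
    (hP : P.toMeasure ≪ volume) {B : ι → Matrix (Fin q) (Fin m) ℝ}
    {B₀ : Matrix (Fin q) (Fin m) ℝ} (hB : Tendsto B l (𝓝 B₀)) (hB₀ : B₀ ∈ frames q m)
    (y : EuclideanSpace ℝ (Fin q)) :
    Tendsto (fun i => halfspaceDepth (projMeasure (ν i).toMeasure (B i)) y) l
      (𝓝 (halfspaceDepth (projMeasure P.toMeasure B₀) y)) := by
  have hconv : ∀ (l' : Filter (ι × EuclideanSpace ℝ (Fin q))) (u₀ : EuclideanSpace ℝ (Fin q)),
      ‖u₀‖ = 1 → Tendsto Prod.fst l' l → Tendsto Prod.snd l' (𝓝 u₀) →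
      Tendsto (fun p => projMeasure (ν p.1).toMeasure (B p.1) (halfspace y p.2)) l'
        (𝓝 (projMeasure P.toMeasure B₀ (halfspace y u₀))) := by
    intro l' u₀ hu₀ h1 h2
    simp only [projMeasure_halfspace]
    have hT : Tendsto (fun p : ι × EuclideanSpace ℝ (Fin q) => (B p.1).transpose) l'
        (𝓝 B₀.transpose) := ((continuous_id.matrix_transpose).tendsto B₀).comp (hB.comp h1)
    refine tendsto_measure_halfspace (ν := fun p : ι × EuclideanSpace ℝ (Fin q) => ν p.1)
      (a := fun p : ι × EuclideanSpace ℝ (Fin q) => Matrix.toEuclideanLin (B p.1).transpose p.2)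
      (a₀ := Matrix.toEuclideanLin B₀.transpose u₀) (hν.comp h1) hP ?_ ?_ ?_
    · exact tendsto_toEuclideanLin hT h2
    · rw [← norm_ne_zero_iff, norm_toEuclideanLin_transpose hB₀, hu₀]; exact one_ne_zero
    · exact h2.inner tendsto_const_nhds
  rw [tendsto_order]
  constructor
  · intro c hc
    obtain ⟨c', hcc', hc'⟩ := exists_between hc
    have hs : {p : ι × EuclideanSpace ℝ (Fin q) |
        c' < projMeasure (ν p.1).toMeasure (B p.1) (halfspace y p.2)} ∈
        l ×ˢ 𝓝ˢ (Metric.sphere (0 : EuclideanSpace ℝ (Fin q)) 1) := by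
      refine (isCompact_sphere _ _).mem_prod_nhdsSet_of_forall fun u hu => ?_
      have hu : ‖u‖ = 1 := by simpa using hu
      exact (hconv _ u hu tendsto_fst tendsto_snd).eventually_const_lt
        (hc'.trans_le (le_halfspaceDepth_iff.1 le_rfl u hu))
    obtain ⟨s, hs, t, ht, hst⟩ := mem_prod_iff.1 hs
    filter_upwards [hs] with i hi
    refine hcc'.trans_le (le_halfspaceDepth_iff.2 fun u hu => ?_)
    exact (hst (Set.mk_mem_prod hi (subset_of_mem_nhdsSet ht (by simpa using hu)))).le
  · intro c hc
    obtain ⟨u, hu, huc⟩ : ∃ u : EuclideanSpace ℝ (Fin q), ‖u‖ = 1 ∧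
        projMeasure P.toMeasure B₀ (halfspace y u) < c := by
      by_contra! h
      exact hc.not_ge (le_halfspaceDepth_iff.2 h)
    have := (hconv (l.map fun i => (i, u)) u hu
      (tendsto_map'_iff.2 tendsto_id) (tendsto_map'_iff.2 tendsto_const_nhds))
    filter_upwards [(tendsto_map'_iff.1 this).eventually_lt_const huc] with i hi
    exact (le_halfspaceDepth_iff.1 le_rfl u hu).trans_lt hi

/-- The halfspace depth regions are closed. -/
lemma isClosed_le_halfspaceDepth (Q : Measure (EuclideanSpace ℝ (Fin k)))
    [IsProbabilityMeasure Q] (t : ℝ≥0∞) : IsClosed {y | t ≤ halfspaceDepth Q y} := by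
  have : {y | t ≤ halfspaceDepth Q y} =
      ⋂ (u : EuclideanSpace ℝ (Fin k)) (_ : ‖u‖ = 1), {y | t ≤ Q (halfspace y u)} := by
    ext y; simp [le_halfspaceDepth_iff]
  rw [this]
  refine isClosed_iInter fun u => isClosed_iInter fun hu => ?_
  refine isClosed_of_closure_subset fun y hy => ?_
  have := mem_closure_iff_nhdsWithin_neBot.1 hy
  have h1 := limsup_measure_halfspace_le (⟨Q, inferInstance⟩ : ProbabilityMeasure _) u
    (l := 𝓝[{y | t ≤ Q (halfspace y u)}] y) (c := fun y => inner ℝ u y) (c₀ := inner ℝ u y)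
    (((by fun_prop : Continuous fun y => inner ℝ u y).tendsto y).mono_left nhdsWithin_le_nhds)
  refine le_trans ?_ h1
  refine le_limsup_of_frequently_le ?_
  exact (eventually_mem_nhdsWithin (s := {y | t ≤ Q (halfspace y u)}) (a := y)).frequently

lemma measurable_halfspaceDepth (Q : Measure (EuclideanSpace ℝ (Fin k)))
    [IsProbabilityMeasure Q] : Measurable (halfspaceDepth Q) :=
  measurable_of_Ici fun t => (isClosed_le_halfspaceDepth Q t).measurableSet

lemma convex_le_halfspaceDepth (Q : Measure (EuclideanSpace ℝ (Fin k))) (t : ℝ≥0∞) :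
    Convex ℝ {y | t ≤ halfspaceDepth Q y} := by
  intro x hx y hy a b ha hb hab
  refine le_halfspaceDepth_iff.2 fun u hu => ?_
  have hcomb : inner ℝ u (a • x + b • y) = a * inner ℝ u x + b * inner ℝ u y := by
    rw [inner_add_right, inner_smul_right, inner_smul_right]
  rcases le_total (inner ℝ u x) (inner ℝ u y) with h | h
  · refine (le_halfspaceDepth_iff.1 hx u hu).trans (measure_mono fun z hz => ?_)
    have hz : inner ℝ u z ≤ inner ℝ u x := hz
    change inner ℝ u z ≤ _
    rw [hcomb]
    linear_combination hz + b * h - hab * inner ℝ u x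
  · refine (le_halfspaceDepth_iff.1 hy u hu).trans (measure_mono fun z hz => ?_)
    have hz : inner ℝ u z ≤ inner ℝ u y := hz
    change inner ℝ u z ≤ _
    rw [hcomb]
    linear_combination hz + a * h - hab * inner ℝ u y

lemma halfspaceDepth_le_measure_norm (Q : Measure (EuclideanSpace ℝ (Fin k)))
    {y : EuclideanSpace ℝ (Fin k)} (hy : y ≠ 0) :
    halfspaceDepth Q y ≤ Q {z | ‖y‖ ≤ ‖z‖} := by
  have hy' : 0 < ‖y‖ := norm_pos_iff.2 hy
  have hu : ‖(-(‖y‖⁻¹ • y))‖ = 1 := by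
    rw [norm_neg, norm_smul, norm_inv, norm_norm, inv_mul_cancel₀ hy'.ne']
  refine (le_halfspaceDepth_iff.1 le_rfl _ hu).trans (measure_mono fun z hz => ?_)
  have hz : inner ℝ (-(‖y‖⁻¹ • y)) z ≤ inner ℝ (-(‖y‖⁻¹ • y)) y := hz
  have h1 : inner ℝ (-(‖y‖⁻¹ • y)) y = -‖y‖ := by
    rw [inner_neg_left, real_inner_smul_left, real_inner_self_eq_norm_mul_norm]
    field_simp
  have h2 := abs_real_inner_le_norm (-(‖y‖⁻¹ • y)) z
  rw [hu, one_mul] at h2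
  change ‖y‖ ≤ ‖z‖
  linarith [neg_abs_le (inner ℝ (-(‖y‖⁻¹ • y)) z)]

lemma halfspaceDepth_le_one [NeZero k] (Q : Measure (EuclideanSpace ℝ (Fin k)))
    [IsProbabilityMeasure Q] (y : EuclideanSpace ℝ (Fin k)) : halfspaceDepth Q y ≤ 1 :=
  (le_halfspaceDepth_iff.1 le_rfl (EuclideanSpace.single 0 1) (by simp)).trans prob_le_one

/-- Uniform tightness: along a weakly convergent sequence, the regions of projected depth more than
a given level are eventually contained in one common ball. -/
lemma exists_ball_halfspaceDepth_lt {ι : Type*} {l : Filter ι}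
    {ν : ι → ProbabilityMeasure (EuclideanSpace ℝ (Fin m))}
    {P : ProbabilityMeasure (EuclideanSpace ℝ (Fin m))} (hν : Tendsto ν l (𝓝 P))
    {B : ι → Matrix (Fin q) (Fin m) ℝ} (hB : ∀ i, B i ∈ frames q m) {ε : ℝ≥0∞} (hε : ε ≠ 0) :
    ∃ R : ℝ, ∀ᶠ i in l, ∀ y : EuclideanSpace ℝ (Fin q), R ≤ ‖y‖ →
      halfspaceDepth (projMeasure (ν i).toMeasure (B i)) y < ε := by
  have hlim : Tendsto (fun n : ℕ => P.toMeasure {x | (n : ℝ) ≤ ‖x‖}) atTop (𝓝 0) := by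
    have := tendsto_measure_iInter_atTop (μ := P.toMeasure) (s := fun n : ℕ => {x | (n : ℝ) ≤ ‖x‖})
      (fun n => (isClosed_le continuous_const continuous_norm).measurableSet.nullMeasurableSet)
      (fun n n' h x (hx : (n' : ℝ) ≤ ‖x‖) => (Nat.cast_le.2 h).trans hx)
      ⟨0, measure_ne_top _ _⟩
    have h0 : (⋂ n : ℕ, {x : EuclideanSpace ℝ (Fin m) | (n : ℝ) ≤ ‖x‖}) = ∅ := by
      refine Set.eq_empty_of_forall_notMem fun x hx => ?_
      obtain ⟨n, hn⟩ := exists_nat_gt ‖x‖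
      exact (not_le.2 hn) (Set.mem_iInter.1 hx n)
    rwa [h0, measure_empty] at this
  obtain ⟨n, hn, hnpos⟩ := ((hlim.eventually_lt_const (pos_iff_ne_zero.2 hε)).and
    (eventually_gt_atTop 0)).exists
  have hcl : IsClosed {x : EuclideanSpace ℝ (Fin m) | (n : ℝ) ≤ ‖x‖} :=
    isClosed_le continuous_const continuous_norm
  rcases l.eq_or_neBot with rfl | hl
  · exact ⟨0, by simp⟩
  refine ⟨n, ?_⟩
  have := (ProbabilityMeasure.limsup_measure_closed_le_of_tendsto hν hcl).trans_lt hn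
  filter_upwards [eventually_lt_of_limsup_lt this] with i hi y hy
  have hn0 : (0 : ℝ) < n := by exact_mod_cast hnpos
  refine (halfspaceDepth_le_measure_norm _ (norm_pos_iff.1 (hn0.trans_le hy))).trans_lt
    (lt_of_le_of_lt ?_ hi)
  rw [projMeasure, Measure.map_apply (measurable_toEuclideanLin _)
    (isClosed_le continuous_const continuous_norm).measurableSet]
  exact measure_mono fun x (hx : ‖y‖ ≤ ‖Matrix.toEuclideanLin (B i) x‖) =>
    hy.trans (hx.trans (norm_toEuclideanLin_le (hB i) x))

end HalfspaceDepth

/-! ### Centerpoints and projections of depth regions -/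

section Centerpoint

variable {q m k : ℕ}

/-- The centerpoint theorem: every finite measure on `ℝᵏ` has a point all of whose closed halfspaces
carry at least the fraction `1 / (k + 1)` of the total mass. -/
lemma exists_centerpoint (ν : Measure (EuclideanSpace ℝ (Fin k))) [IsFiniteMeasure ν] :
    ∃ c, ∀ u, ν Set.univ ≤ ((k + 1 : ℕ) : ℝ≥0∞) * ν (halfspace c u) := by
  set p : Set (EuclideanSpace ℝ (Fin k)) → Prop := fun C =>
    Convex ℝ C ∧ IsCompact C ∧ ((k + 1 : ℕ) : ℝ≥0∞) * ν Cᶜ < ν Set.univ with hp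
  -- By Helly, the compact convex sets that miss less than `1 / (k + 1)` of the mass have a common
  -- point, since any `k + 1` of them do.
  obtain ⟨c, hc⟩ := Convex.helly_theorem_compact' (𝕜 := ℝ) (F := fun C : {C // p C} => C.1)
    (fun C => C.2.1) (fun C => C.2.2.1) (by
      intro I hI
      rw [finrank_euclideanSpace_fin] at hI
      rcases I.eq_empty_or_nonempty with rfl | hne
      · simp
      by_contra hempty
      rw [Set.not_nonempty_iff_eq_empty] at hempty
      have hcover : ν Set.univ ≤ ∑ C ∈ I, ν (C.1)ᶜ := by
        refine le_trans (measure_mono ?_) (measure_biUnion_finset_le I fun C => (C.1)ᶜ)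
        rw [← Set.compl_iInter₂, hempty, Set.compl_empty]
      have hlt : ∑ C ∈ I, ((k + 1 : ℕ) : ℝ≥0∞) * ν (C.1)ᶜ < ∑ _C ∈ I, ν Set.univ :=
        ENNReal.sum_lt_sum_of_nonempty hne fun C _ => C.2.2.2
      rw [← Finset.mul_sum, Finset.sum_const, nsmul_eq_mul] at hlt
      have h1 : ((k + 1 : ℕ) : ℝ≥0∞) * ν Set.univ < (I.card : ℝ≥0∞) * ν Set.univ :=
        lt_of_le_of_lt (by gcongr) hlt
      exact absurd h1 (not_lt.2 (by gcongr)))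
  refine ⟨c, fun u => ?_⟩
  by_contra! hlt
  set C : ℕ → Set (EuclideanSpace ℝ (Fin k)) := fun n =>
    {x | inner ℝ u c + 1 / ((n : ℝ) + 1) ≤ inner ℝ u x} ∩ Metric.closedBall 0 n with hC
  have hCclosed : ∀ n, IsClosed {x | inner ℝ u c + 1 / ((n : ℝ) + 1) ≤ inner ℝ u x} := fun n =>
    isClosed_le continuous_const (by fun_prop)
  have hCmono : Monotone C := by
    intro n n' h x hx
    have h' : (n : ℝ) ≤ n' := by exact_mod_cast h
    have h1 : inner ℝ u c + 1 / ((n : ℝ) + 1) ≤ inner ℝ u x := hx.1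
    have h2 : 1 / ((n' : ℝ) + 1) ≤ 1 / ((n : ℝ) + 1) := by gcongr
    refine ⟨?_, Metric.closedBall_subset_closedBall h' hx.2⟩
    change inner ℝ u c + 1 / ((n' : ℝ) + 1) ≤ inner ℝ u x
    linarith
  have hInter : ⋂ n, (C n)ᶜ = halfspace c u := by
    rw [← Set.compl_iUnion]
    ext x
    simp only [Set.mem_compl_iff, Set.mem_iUnion, not_exists]
    constructor
    · intro h
      by_contra hx
      have hx : inner ℝ u c < inner ℝ u x := not_le.1 hx
      obtain ⟨n₁, hn₁⟩ := exists_nat_one_div_lt (sub_pos.2 hx)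
      obtain ⟨n₂, hn₂⟩ := exists_nat_ge ‖x‖
      refine h (max n₁ n₂) ⟨?_, ?_⟩
      · have : 1 / (((max n₁ n₂ : ℕ) : ℝ) + 1) ≤ 1 / ((n₁ : ℝ) + 1) := by
          gcongr; exact le_max_left _ _
        change inner ℝ u c + 1 / (((max n₁ n₂ : ℕ) : ℝ) + 1) ≤ inner ℝ u x
        linarith
      · rw [mem_closedBall_zero_iff]
        exact hn₂.trans (by exact_mod_cast le_max_right _ _)
    · rintro (h : inner ℝ u x ≤ inner ℝ u c) n ⟨hn, -⟩
      have hn : inner ℝ u c + 1 / ((n : ℝ) + 1) ≤ inner ℝ u x := hn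
      have : (0 : ℝ) < 1 / ((n : ℝ) + 1) := by positivity
      linarith
  have hlim := tendsto_measure_iInter_atTop (μ := ν) (s := fun n => (C n)ᶜ)
    (fun n => ((hCclosed n).inter Metric.isClosed_closedBall).measurableSet.compl.nullMeasurableSet)
    (fun n n' h => Set.compl_subset_compl.2 (hCmono h)) ⟨0, measure_ne_top _ _⟩
  rw [hInter] at hlim
  have hlim' := ENNReal.Tendsto.const_mul (a := ((k + 1 : ℕ) : ℝ≥0∞)) hlim
    (Or.inr (ENNReal.natCast_ne_top _))
  obtain ⟨n, hn⟩ := (hlim'.eventually_lt_const hlt).exists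
  have hconv : Convex ℝ (C n) :=
    (convex_halfSpace_ge (innerₛₗ ℝ u).isLinear _).inter (convex_closedBall _ _)
  have hcomp : IsCompact (C n) := (isCompact_closedBall _ _).inter_left (hCclosed n)
  have hcn : c ∈ C n := Set.mem_iInter.1 hc ⟨C n, hconv, hcomp, hn⟩
  have hcn' : inner ℝ u c + 1 / ((n : ℝ) + 1) ≤ inner ℝ u c := hcn.1
  have : (0 : ℝ) < 1 / ((n : ℝ) + 1) := by positivity
  linarith

lemma le_measure_halfspace_of_le_halfspaceDepth {Q : Measure (EuclideanSpace ℝ (Fin k))}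
    {t : ℝ≥0∞} {y : EuclideanSpace ℝ (Fin k)} (h : t ≤ halfspaceDepth Q y)
    {w : EuclideanSpace ℝ (Fin k)} (hw : w ≠ 0) : t ≤ Q (halfspace y w) := by
  have hw' : 0 < ‖w‖⁻¹ := inv_pos.2 (norm_pos_iff.2 hw)
  have h1 := le_halfspaceDepth_iff.1 h (‖w‖⁻¹ • w) (by
    rw [norm_smul, norm_inv, norm_norm, inv_mul_cancel₀ (norm_ne_zero_iff.2 hw)])
  have h2 : halfspace y (‖w‖⁻¹ • w) = halfspace y w := by
    ext z
    simp only [halfspace, real_inner_smul_left, Set.mem_ofPred_eq]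
    exact mul_le_mul_iff_right₀ hw'
  rwa [h2] at h1

lemma isCompact_le_halfspaceDepth [NeZero k] (Q : Measure (EuclideanSpace ℝ (Fin k)))
    [IsProbabilityMeasure Q] {t : ℝ≥0∞} (ht : t ≠ 0) :
    IsCompact {y | t ≤ halfspaceDepth Q y} := by
  obtain ⟨R, hR⟩ := exists_ball_halfspaceDepth_lt (l := pure ()) (q := k)
    (ν := fun _ => (⟨Q, inferInstance⟩ : ProbabilityMeasure (EuclideanSpace ℝ (Fin k))))
    tendsto_const_nhds (B := fun _ => 1) (fun _ => by simp [frames]) ht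
  have h1 : projMeasure Q (1 : Matrix (Fin k) (Fin k) ℝ) = Q := by
    simp [projMeasure]
  refine (isCompact_closedBall (0 : EuclideanSpace ℝ (Fin k)) R).of_isClosed_subset
    (isClosed_le_halfspaceDepth Q t) fun y hy => ?_
  rw [mem_closedBall_zero_iff]
  by_contra! hlt
  have := eventually_pure.1 hR y hlt.le
  simp only [ProbabilityMeasure.coe_mk, h1] at this
  exact absurd hy (not_le.2 this)

/-- A region of projected depth is contained in the projection of the depth region whose level is
smaller by the factor `m + 1`: a halfspace that carries mass `t` contains a point of depth at least
`t / (m + 1)`, namely a centerpoint of the law restricted to it. -/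
lemma le_halfspaceDepth_projMeasure_subset_image [NeZero q] [NeZero m]
    (ν : Measure (EuclideanSpace ℝ (Fin m))) [IsProbabilityMeasure ν]
    (B : Matrix (Fin q) (Fin m) ℝ) {t : ℝ≥0∞} (ht : t ≠ 0) :
    {y | t ≤ halfspaceDepth (projMeasure ν B) y} ⊆
      Matrix.toEuclideanLin B '' {x | t / ((m + 1 : ℕ) : ℝ≥0∞) ≤ halfspaceDepth ν x} := by
  intro y hy
  have hy : t ≤ halfspaceDepth (projMeasure ν B) y := hy
  by_contra hyD
  have := isProbabilityMeasure_projMeasure ν B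
  have hcomp : IsCompact (Matrix.toEuclideanLin B ''
      {x | t / ((m + 1 : ℕ) : ℝ≥0∞) ≤ halfspaceDepth ν x}) :=
    (isCompact_le_halfspaceDepth ν (ENNReal.div_ne_zero.2
      ⟨ht, ENNReal.natCast_ne_top _⟩)).image (LinearMap.continuous_of_finiteDimensional _)
  obtain ⟨f, r, hfy, hf⟩ := geometric_hahn_banach_point_closed
    ((convex_le_halfspaceDepth ν _).linear_image (Matrix.toEuclideanLin B)) hcomp.isClosed hyD
  set w := (InnerProductSpace.toDual ℝ (EuclideanSpace ℝ (Fin q))).symm f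
  have hw : ∀ z, f z = inner ℝ w z := fun z =>
    (InnerProductSpace.toDual_symm_apply (x := z) (y := f)).symm
  set w' := Matrix.toEuclideanLin B.transpose w
  set H : Set (EuclideanSpace ℝ (Fin m)) := {x | inner ℝ w' x ≤ inner ℝ w y} with hH
  have hHm : MeasurableSet H := (isClosed_le (by fun_prop) continuous_const).measurableSet
  have htH : t ≤ ν H := by
    by_cases hw0 : w = 0
    · have h1 : H = Set.univ := by simp [hH, w', hw0]
      rw [h1, measure_univ]
      exact hy.trans (halfspaceDepth_le_one _ _)
    · have := le_measure_halfspace_of_le_halfspaceDepth hy hw0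
      rwa [projMeasure_halfspace] at this
  obtain ⟨c, hc⟩ := exists_centerpoint (ν.restrict H)
  rw [Measure.restrict_apply_univ] at hc
  have hcK : t / ((m + 1 : ℕ) : ℝ≥0∞) ≤ halfspaceDepth ν c := by
    refine le_halfspaceDepth_iff.2 fun u _ => ?_
    refine ENNReal.div_le_of_le_mul' (htH.trans ((hc u).trans ?_))
    gcongr
    exact Measure.restrict_le_self
  have hcH : c ∈ H := by
    by_contra hcH
    have hcH : inner ℝ w y < inner ℝ w' c := not_le.1 hcH
    have h0 : ν.restrict H (halfspace c (-w')) = 0 := by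
      rw [Measure.restrict_apply (isClosed_halfspace _ _).measurableSet]
      convert measure_empty (μ := ν)
      refine Set.eq_empty_of_forall_notMem ?_
      rintro x ⟨h1, h2⟩
      have h1 : inner ℝ (-w') x ≤ inner ℝ (-w') c := h1
      have h2 : inner ℝ w' x ≤ inner ℝ w y := h2
      rw [inner_neg_left, inner_neg_left] at h1
      linarith
    have := hc (-w')
    rw [h0, mul_zero] at this
    exact ht (le_antisymm (htH.trans this) bot_le)
  have h1 := hf _ ⟨c, hcK, rfl⟩
  rw [hw, inner_toEuclideanLin] at h1
  rw [hw] at hfy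
  have h2 : inner ℝ w' c ≤ inner ℝ w y := hcH
  linarith

lemma image_le_halfspaceDepth_subset (ν : Measure (EuclideanSpace ℝ (Fin m)))
    {B : Matrix (Fin q) (Fin m) ℝ} (hB : B ∈ frames q m) (t : ℝ≥0∞) :
    Matrix.toEuclideanLin B '' {x | t ≤ halfspaceDepth ν x} ⊆
      {y | t ≤ halfspaceDepth (projMeasure ν B) y} := by
  rintro _ ⟨x, hx, rfl⟩
  refine le_halfspaceDepth_iff.2 fun u hu => ?_
  rw [projMeasure_halfspace, inner_toEuclideanLin]
  exact le_halfspaceDepth_iff.1 hx _ ((norm_toEuclideanLin_transpose hB u).trans hu)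

end Centerpoint

/-! ### Volumes of simplices and of projections of convex bodies -/

section Simplex

variable {q m : ℕ}

/-- The matrix whose columns are the edges issuing from the vertex `w 0` of the simplex with
vertices `w`. -/
def edgeMatrix (w : Fin (q + 1) → EuclideanSpace ℝ (Fin q)) : Matrix (Fin q) (Fin q) ℝ :=
  Matrix.of fun i l => w l.succ i - w 0 i

/-- The vertices `0, e₁, …, e_q` of the corner simplex in `ℝ^q`. -/
def cornerVertex (q : ℕ) : Fin (q + 1) → EuclideanSpace ℝ (Fin q) :=
  Fin.cons 0 fun l => EuclideanSpace.single l 1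

lemma det_toEuclideanLin (M : Matrix (Fin q) (Fin q) ℝ) :
    LinearMap.det (Matrix.toEuclideanLin M) = M.det := by
  change LinearMap.det (Matrix.toLpLin 2 2 M) = M.det
  rw [Matrix.toLpLin_eq_toLin, LinearMap.det_toLin]

lemma volume_affine_image (M : Matrix (Fin q) (Fin q) ℝ) (b : EuclideanSpace ℝ (Fin q))
    (s : Set (EuclideanSpace ℝ (Fin q))) :
    volume ((fun x => Matrix.toEuclideanLin M x + b) '' s) =
      ENNReal.ofReal |M.det| * volume s := by
  have h : (fun x => Matrix.toEuclideanLin M x + b) '' s =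
      (fun x => x + b) '' (Matrix.toEuclideanLin M '' s) := by rw [Set.image_image]
  rw [h, Set.image_add_right, measure_preimage_add_right, Measure.addHaar_image_linearMap,
    det_toEuclideanLin]

lemma volume_convexHull_range (w : Fin (q + 1) → EuclideanSpace ℝ (Fin q)) :
    volume (convexHull ℝ (Set.range w)) =
      ENNReal.ofReal |(edgeMatrix w).det| * volume (convexHull ℝ (Set.range (cornerVertex q))) := by
  set T : EuclideanSpace ℝ (Fin q) →ᵃ[ℝ] EuclideanSpace ℝ (Fin q) :=
    (Matrix.toEuclideanLin (edgeMatrix w)).toAffineMap + AffineMap.const ℝ _ (w 0)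
  have hT : ∀ x, T x = Matrix.toEuclideanLin (edgeMatrix w) x + w 0 := fun x => rfl
  have hw : Set.range w = T '' Set.range (cornerVertex q) := by
    rw [← Set.range_comp]
    congr 1
    ext i j
    simp only [Function.comp_apply, hT]
    refine Fin.cases ?_ (fun l => ?_) i
    · simp [cornerVertex]
    · simp [cornerVertex, edgeMatrix, Matrix.toLpLin_apply]
  rw [hw, ← AffineMap.image_convexHull]
  exact volume_affine_image _ _ _

lemma volume_cornerSimplex_ne_top : volume (convexHull ℝ (Set.range (cornerVertex q))) ≠ ∞ :=
  ((Set.finite_range _).isCompact_convexHull (𝕜 := ℝ)).measure_lt_top.ne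

lemma volume_cornerSimplex_ne_zero : volume (convexHull ℝ (Set.range (cornerVertex q))) ≠ 0 := by
  set U : Set (EuclideanSpace ℝ (Fin q)) := (⋂ i, {x | 0 < x i}) ∩ {x | ∑ i, x i < 1}
  have hU : IsOpen U :=
    (isOpen_iInter_of_finite fun i => isOpen_lt continuous_const (by fun_prop)).inter
      (isOpen_lt (by fun_prop) continuous_const)
  have hne : U.Nonempty := by
    refine ⟨WithLp.toLp 2 fun _ => 1 / ((q : ℝ) + 1), Set.mem_iInter.2 fun i => ?_, ?_⟩
    · change (0 : ℝ) < 1 / ((q : ℝ) + 1)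
      positivity
    · change ∑ _i : Fin q, 1 / ((q : ℝ) + 1) < 1
      rw [Finset.sum_const, Finset.card_univ, Fintype.card_fin, nsmul_eq_mul, mul_one_div,
        div_lt_one (by positivity)]
      linarith
  refine ((hU.measure_pos volume hne).trans_le (measure_mono ?_)).ne'
  rintro x ⟨h1, h2⟩
  have h2 : ∑ i, x i < 1 := h2
  refine mem_convexHull_of_exists_fintype (ι := Fin (q + 1)) (Fin.cons (1 - ∑ i, x i) fun l => x l)
    (cornerVertex q) ?_ ?_ (fun i => Set.mem_range_self i) ?_
  · intro i
    refine Fin.cases ?_ (fun l => ?_) i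
    · simp only [Fin.cons_zero]; linarith
    · simp only [Fin.cons_succ]; exact (Set.mem_iInter.1 h1 l).le
  · simp [Fin.sum_univ_succ]
  · ext j
    simp [Fin.sum_univ_succ, cornerVertex, Finset.sum_apply, Pi.single_apply]

/-- The cube `[-1, 1]^q`. -/
def unitCube (q : ℕ) : Set (EuclideanSpace ℝ (Fin q)) := {c | ∀ i, |c i| ≤ 1}

lemma volume_unitCube_ne_top : volume (unitCube q) ≠ ∞ := by
  refine ((measure_mono fun c hc => ?_).trans_lt
    (measure_closedBall_lt_top (x := (0 : EuclideanSpace ℝ (Fin q))) (r := √q))).ne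
  rw [mem_closedBall_zero_iff, EuclideanSpace.norm_eq]
  refine Real.sqrt_le_sqrt ?_
  calc ∑ i, ‖c i‖ ^ 2 ≤ ∑ _i : Fin q, (1 : ℝ) :=
        Finset.sum_le_sum fun i _ => by
          rw [Real.norm_eq_abs]; exact pow_le_one₀ (abs_nonneg _) (hc i)
    _ = q := by simp

/-- A convex body is contained in a parallelepiped spanned by the edges of a largest simplex
inscribed in it. -/
lemma exists_simplex_volume_le {D : Set (EuclideanSpace ℝ (Fin q))} (hD : Convex ℝ D)
    (hDc : IsCompact D) (hne : D.Nonempty) :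
    ∃ y : Fin (q + 1) → EuclideanSpace ℝ (Fin q), (∀ i, y i ∈ D) ∧
      volume D ≤ ENNReal.ofReal |(edgeMatrix y).det| * volume (unitCube q) := by
  have hcont : Continuous fun y : Fin (q + 1) → EuclideanSpace ℝ (Fin q) =>
      |(edgeMatrix y).det| := by
    refine (Continuous.matrix_det ?_).abs
    exact continuous_matrix fun i l => by simp only [edgeMatrix, Matrix.of_apply]; fun_prop
  obtain ⟨y, hyD, hymax⟩ := (isCompact_univ_pi fun _ : Fin (q + 1) => hDc).exists_isMaxOn
    ⟨fun _ => hne.some, fun _ _ => hne.some_mem⟩ hcont.continuousOn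
  refine ⟨y, fun i => hyD i trivial, ?_⟩
  by_cases hvol : volume D = 0
  · rw [hvol]; exact bot_le
  have hdet : (edgeMatrix y).det ≠ 0 := by
    -- a body of positive volume contains a small corner simplex
    have hint : (interior D).Nonempty := by
      by_contra h
      rw [Set.not_nonempty_iff_eq_empty] at h
      refine hvol (measure_mono_null ?_ (hD.addHaar_frontier volume))
      rw [frontier, h, Set.sdiff_empty]
      exact subset_closure
    obtain ⟨z, hz⟩ := hint
    obtain ⟨r, hr, hball⟩ := Metric.isOpen_iff.1 isOpen_interior z hz
    have hmem : ∀ i, (Fin.cons z fun l => z + EuclideanSpace.single l (r / 2) :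
        Fin (q + 1) → EuclideanSpace ℝ (Fin q)) i ∈ D := by
      intro i
      refine Fin.cases ?_ (fun l => ?_) i
      · simpa using interior_subset hz
      · simp only [Fin.cons_succ]
        refine interior_subset (hball ?_)
        rw [mem_ball_iff_norm, add_sub_cancel_left, PiLp.norm_single, Real.norm_eq_abs,
          abs_of_pos (by positivity)]
        linarith
    have h1 : edgeMatrix (Fin.cons z fun l => z + EuclideanSpace.single l (r / 2)) =
        (r / 2) • (1 : Matrix (Fin q) (Fin q) ℝ) := by
      ext i l
      simp [edgeMatrix, Matrix.one_apply]
    have h2 := hymax (a := Fin.cons z fun l => z + EuclideanSpace.single l (r / 2))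
      (fun i _ => hmem i)
    have h2 : |(edgeMatrix (Fin.cons z fun l => z + EuclideanSpace.single l (r / 2))).det| ≤
      |(edgeMatrix y).det| := h2
    rw [h1, Matrix.det_smul, Matrix.det_one, mul_one] at h2
    rw [← abs_pos]
    exact lt_of_lt_of_le (by positivity) h2
  rw [← volume_affine_image _ (y 0)]
  refine measure_mono fun x hx => ?_
  set M := edgeMatrix y with hM
  set b : Fin q → ℝ := fun i => x i - y 0 i with hb
  -- Cramer's rule; the numerators are determinants of inscribed simplices
  refine ⟨WithLp.toLp 2 (M.det⁻¹ • M.cramer b), fun i => ?_, ?_⟩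
  · have h1 : M.updateCol i b = edgeMatrix (Function.update y i.succ x) := by
      ext j l
      by_cases hl : l = i
      · subst hl; simp [edgeMatrix, hb, Function.update_of_ne (Fin.succ_ne_zero l).symm]
      · simp [edgeMatrix, hl, hM, Function.update_of_ne (Fin.succ_ne_zero i).symm]
    have h2 : |(edgeMatrix (Function.update y i.succ x)).det| ≤ |M.det| := by
      refine hymax (a := Function.update y i.succ x) fun j _ => ?_
      by_cases hj : j = i.succ
      · subst hj; simpa using hx
      · simpa [Function.update_of_ne hj] using hyD j trivial
    simp only [Pi.smul_apply, smul_eq_mul, Matrix.cramer_apply]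
    rw [h1, abs_mul, abs_inv, inv_mul_le_iff₀ (abs_pos.2 hdet), mul_one]
    exact h2
  · ext i
    simp only [Matrix.toLpLin_apply, Matrix.mulVec_smul, Matrix.mulVec_cramer]
    simp [hb, inv_mul_cancel_left₀ hdet]

/-- Expansion of the determinant of a product of rectangular matrices in the rows of the second
factor. -/
lemma det_mul_eq_sum (b : Matrix (Fin q) (Fin m) ℝ) (W : Matrix (Fin m) (Fin q) ℝ) :
    (b * W).det = ∑ f : Fin q → Fin m, (∏ i, b i (f i)) * (W.submatrix f id).det := by
  have h : (b * W).det = Matrix.detRowAlternating.toMultilinearMap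
      (fun i => ∑ j, b i j • W j) := by
    change Matrix.detRowAlternating (b * W) = Matrix.detRowAlternating _
    congr 1
    ext i l
    simp [Matrix.mul_apply, Finset.sum_apply]
  rw [h, MultilinearMap.map_sum]
  refine Finset.sum_congr rfl fun f _ => ?_
  rw [MultilinearMap.map_smul_univ, smul_eq_mul]
  rfl

lemma abs_det_edgeMatrix_le {b : Matrix (Fin q) (Fin m) ℝ} (hb : ∀ i j, |b i j| ≤ 1)
    (O : Matrix (Fin m) (Fin m) ℝ) (x : Fin (q + 1) → EuclideanSpace ℝ (Fin m)) :
    |(edgeMatrix fun i => Matrix.toEuclideanLin (b * O) (x i)).det| ≤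
      ∑ f : Fin q ↪ Fin m,
        |(edgeMatrix fun i => Matrix.toEuclideanLin (O.submatrix f id) (x i)).det| := by
  set W : Matrix (Fin m) (Fin q) ℝ := Matrix.of fun j l =>
    Matrix.toEuclideanLin O (x l.succ) j - Matrix.toEuclideanLin O (x 0) j with hW
  have h1 : (edgeMatrix fun i => Matrix.toEuclideanLin (b * O) (x i)) = b * W := by
    ext i l
    simp only [edgeMatrix, hW, Matrix.of_apply, Matrix.toLpLin_apply, Matrix.mul_apply,
      ← Matrix.mulVec_mulVec]
    simp only [Matrix.mulVec, dotProduct, mul_sub, Finset.sum_sub_distrib]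
  have h2 : ∀ f : Fin q → Fin m,
      (edgeMatrix fun i => Matrix.toEuclideanLin (O.submatrix f id) (x i)) = W.submatrix f id := by
    intro f
    ext i l
    simp [edgeMatrix, hW, Matrix.toLpLin_apply, Matrix.mulVec, dotProduct]
  simp only [h1, h2, det_mul_eq_sum]
  refine (Finset.abs_sum_le_sum_abs _ _).trans ?_
  have h3 : ∑ f : Fin q ↪ Fin m, |(W.submatrix f id).det| =
      ∑ f : Fin q → Fin m, |(W.submatrix f id).det| := by
    refine Finset.sum_of_injOn (fun f : Fin q ↪ Fin m => (f : Fin q → Fin m))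
      DFunLike.coe_injective.injOn (fun _ _ => by simp) (fun f _ hf => ?_) fun _ _ => rfl
    have hf' : ¬ Function.Injective f := fun h => hf ⟨⟨f, h⟩, by simp, rfl⟩
    simp only [Function.Injective, not_forall] at hf'
    obtain ⟨i, j, hij, hne⟩ := hf'
    rw [Matrix.det_zero_of_row_eq hne (by ext l; simp [hij]), abs_zero]
  rw [h3]
  refine Finset.sum_le_sum fun f _ => ?_
  rw [abs_mul, Finset.abs_prod]
  refine mul_le_of_le_one_left (abs_nonneg _) (Finset.prod_le_one (fun _ _ => abs_nonneg _) ?_)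
  exact fun i _ => hb i (f i)

/-- The matrix formed by `q` distinct rows of an orthogonal matrix. -/
lemma submatrix_mem_frames {O : Matrix (Fin m) (Fin m) ℝ} (hO : O ∈ frames m m)
    (f : Fin q ↪ Fin m) : O.submatrix f id ∈ frames q m := by
  change O.submatrix f id * (O.submatrix f id).transpose = 1
  rw [Matrix.transpose_submatrix, ← Matrix.submatrix_mul _ _ f id f Function.bijective_id,
    show O * O.transpose = 1 from hO, Matrix.submatrix_one_embedding]

lemma transpose_mul_self_of_mem_frames {O : Matrix (Fin m) (Fin m) ℝ} (hO : O ∈ frames m m) :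
    O.transpose * O = 1 :=
  mul_eq_one_comm.1 (show O * O.transpose = 1 from hO)

variable (q m) in
/-- The volume of a projection of a convex body is controlled by the volumes of its projections to
the `q`-dimensional coordinate planes of any orthonormal basis. -/
lemma exists_volume_image_le : ∃ C : ℝ≥0∞, C ≠ ∞ ∧ ∀ O ∈ frames m m, ∀ B ∈ frames q m,
    ∀ K : Set (EuclideanSpace ℝ (Fin m)), Convex ℝ K → IsCompact K →
      volume (Matrix.toEuclideanLin B '' K) ≤
        C * ∑ f : Fin q ↪ Fin m, volume (Matrix.toEuclideanLin (O.submatrix f id) '' K) := by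
  set c := volume (convexHull ℝ (Set.range (cornerVertex q))) with hc
  have hc0 : c ≠ 0 := volume_cornerSimplex_ne_zero
  have hct : c ≠ ∞ := volume_cornerSimplex_ne_top
  refine ⟨volume (unitCube q) * c⁻¹,
    ENNReal.mul_ne_top volume_unitCube_ne_top (ENNReal.inv_ne_top.2 hc0), ?_⟩
  intro O hO B hB K hK hKc
  rcases K.eq_empty_or_nonempty with rfl | hne
  · simp
  obtain ⟨y, hy, hvol⟩ := exists_simplex_volume_le (hK.linear_image (Matrix.toEuclideanLin B))
    (hKc.image (LinearMap.continuous_of_finiteDimensional _)) (hne.image _)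
  choose x hxK hxy using hy
  have hb : B * O.transpose ∈ frames q m := by
    change B * O.transpose * (B * O.transpose).transpose = 1
    rw [Matrix.transpose_mul, Matrix.transpose_transpose, Matrix.mul_assoc,
      ← Matrix.mul_assoc O.transpose, transpose_mul_self_of_mem_frames hO, Matrix.one_mul]
    exact hB
  have hbO : B * O.transpose * O = B := by
    rw [Matrix.mul_assoc, transpose_mul_self_of_mem_frames hO, Matrix.mul_one]
  have h1 := abs_det_edgeMatrix_le (abs_le_one_of_mem_frames hb) O x
  rw [hbO, show (fun i => Matrix.toEuclideanLin B (x i)) = y from funext hxy] at h1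
  calc volume (Matrix.toEuclideanLin B '' K)
      ≤ ENNReal.ofReal |(edgeMatrix y).det| * volume (unitCube q) := hvol
    _ ≤ ENNReal.ofReal (∑ f : Fin q ↪ Fin m,
          |(edgeMatrix fun i => Matrix.toEuclideanLin (O.submatrix f id) (x i)).det|) *
          volume (unitCube q) := by gcongr
    _ = volume (unitCube q) * c⁻¹ * ∑ f : Fin q ↪ Fin m, ENNReal.ofReal
          |(edgeMatrix fun i => Matrix.toEuclideanLin (O.submatrix f id) (x i)).det| * c := by
        rw [ENNReal.ofReal_sum_of_nonneg fun _ _ => abs_nonneg _, ← Finset.sum_mul,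
          mul_comm (∑ f : Fin q ↪ Fin m, _) c, ← mul_assoc, mul_assoc (volume _),
          ENNReal.inv_mul_cancel hc0 hct, mul_one, mul_comm]
    _ ≤ _ := by
        gcongr with f
        rw [hc, ← volume_convexHull_range]
        refine measure_mono (convexHull_min ?_ (hK.linear_image _))
        rintro _ ⟨i, rfl⟩
        exact ⟨x i, hxK i, rfl⟩

end Simplex

/-! ### Dispersion with respect to halfspace depth -/

section Truncation

variable {α : Type*} [MeasurableSpace α] {μ : Measure α}

lemma lintegral_eq_lintegral_measure_ofReal_le {f : α → ℝ≥0∞} (hf : Measurable f)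
    (hfin : ∀ x, f x ≠ ∞) :
    ∫⁻ x, f x ∂μ = ∫⁻ t in Set.Ioi (0 : ℝ), μ {x | ENNReal.ofReal t ≤ f x} := by
  have h := lintegral_eq_lintegral_meas_le μ (f := fun x => (f x).toReal)
    (Eventually.of_forall fun _ => ENNReal.toReal_nonneg) hf.ennreal_toReal.aemeasurable
  simpa only [ENNReal.ofReal_toReal (hfin _), ENNReal.ofReal_le_iff_le_toReal (hfin _)] using h

lemma lintegral_eq_lintegral_min_add {f : α → ℝ≥0∞} (hf : Measurable f) (ε : ℝ≥0∞) :
    ∫⁻ x, f x ∂μ = ∫⁻ x, min (f x) ε ∂μ + ∫⁻ x, (f x - ε) ∂μ := by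
  rw [← lintegral_add_left (hf.min measurable_const)]
  refine lintegral_congr fun x => ?_
  rcases le_total (f x) ε with h | h
  · rw [min_eq_left h, tsub_eq_zero_of_le h, add_zero]
  · rw [min_eq_right h, add_tsub_cancel_of_le h]

/-- If the integrals of a pointwise convergent sequence converge to the finite integral of the
limit, then so do the integrals of the truncated functions. -/
lemma tendsto_lintegral_min {f : ℕ → α → ℝ≥0∞} {g : α → ℝ≥0∞} (hf : ∀ n, Measurable (f n))
    (hg : Measurable g) (hlim : ∀ x, Tendsto (fun n => f n x) atTop (𝓝 (g x)))
    (hgi : ∫⁻ x, g x ∂μ ≠ ∞)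
    (hint : Tendsto (fun n => ∫⁻ x, f n x ∂μ) atTop (𝓝 (∫⁻ x, g x ∂μ))) (ε : ℝ≥0∞) :
    Tendsto (fun n => ∫⁻ x, min (f n x) ε ∂μ) atTop (𝓝 (∫⁻ x, min (g x) ε ∂μ)) := by
  have hlow : ∫⁻ x, min (g x) ε ∂μ ≤ liminf (fun n => ∫⁻ x, min (f n x) ε ∂μ) atTop := by
    refine le_trans (le_of_eq (lintegral_congr fun x => ?_))
      (lintegral_liminf_le fun n => (hf n).min measurable_const)
    exact ((hlim x).min tendsto_const_nhds).liminf_eq.symm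
  have hneg : Tendsto (fun n => ∫⁻ x, (g x - f n x) ∂μ) atTop (𝓝 0) := by
    have hgfin : ∀ᵐ x ∂μ, g x < ∞ := ae_lt_top hg hgi
    have := tendsto_lintegral_of_dominated_convergence (μ := μ) (F := fun n x => g x - f n x)
      (f := fun _ => 0) g (fun n => hg.sub (hf n))
      (fun n => Eventually.of_forall fun x => tsub_le_self) hgi (by
        filter_upwards [hgfin] with x hx
        have := ENNReal.Tendsto.sub (tendsto_const_nhds (x := g x) (f := atTop)) (hlim x)
          (Or.inl hx.ne)
        simpa using this)
    simpa using this
  have hsub : ∫⁻ x, (g x - ε) ∂μ ≠ ∞ :=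
    ne_top_of_le_ne_top hgi (lintegral_mono fun x => tsub_le_self)
  have hupper : ∀ n, ∫⁻ x, min (f n x) ε ∂μ ≤
      ∫⁻ x, f n x ∂μ + ∫⁻ x, (g x - f n x) ∂μ - ∫⁻ x, (g x - ε) ∂μ := by
    intro n
    refine ENNReal.le_sub_of_add_le_right hsub ?_
    calc ∫⁻ x, min (f n x) ε ∂μ + ∫⁻ x, (g x - ε) ∂μ
        ≤ ∫⁻ x, min (f n x) ε ∂μ + ∫⁻ x, ((f n x - ε) + (g x - f n x)) ∂μ := by
          gcongr with x
          rw [tsub_le_iff_right]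
          calc g x ≤ f n x + (g x - f n x) := le_add_tsub
            _ ≤ (f n x - ε + ε) + (g x - f n x) := by gcongr; exact le_tsub_add
            _ = _ := by ring
      _ = ∫⁻ x, f n x ∂μ + ∫⁻ x, (g x - f n x) ∂μ := by
          have hm : Measurable fun x => g x - f n x := hg.sub (hf n)
          rw [lintegral_add_right _ hm, ← add_assoc,
            ← lintegral_eq_lintegral_min_add (hf n)]
  have hlim' : Tendsto (fun n => ∫⁻ x, f n x ∂μ + ∫⁻ x, (g x - f n x) ∂μ - ∫⁻ x, (g x - ε) ∂μ)
      atTop (𝓝 (∫⁻ x, min (g x) ε ∂μ)) := by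
    have := ENNReal.Tendsto.sub (hint.add hneg)
      (tendsto_const_nhds (x := ∫⁻ x, (g x - ε) ∂μ)) (Or.inr hsub)
    rw [add_zero, lintegral_eq_lintegral_min_add hg ε, ENNReal.add_sub_cancel_right hsub] at this
    exact this
  refine tendsto_of_le_liminf_of_limsup_le hlow ?_
  rw [← hlim'.limsup_eq]
  exact limsup_le_limsup (Eventually.of_forall hupper)

lemma tendsto_lintegral_min_zero {g : α → ℝ≥0∞} (hg : Measurable g) (hgi : ∫⁻ x, g x ∂μ ≠ ∞) :
    Tendsto (fun n : ℕ => ∫⁻ x, min (g x) ((n : ℝ≥0∞)⁻¹) ∂μ) atTop (𝓝 0) := by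
  have := tendsto_lintegral_of_dominated_convergence (μ := μ)
    (F := fun (n : ℕ) x => min (g x) ((n : ℝ≥0∞)⁻¹)) (f := fun _ => 0) g
    (fun n => hg.min measurable_const) (fun n => Eventually.of_forall fun x => min_le_left _ _) hgi
    (Eventually.of_forall fun x => by
      have := (tendsto_const_nhds (x := g x)).min ENNReal.tendsto_inv_nat_nhds_zero
      simpa using this)
  simpa using this

end Truncation

section HalfspaceDispersion

variable {q m : ℕ}

instance instIsProbabilityMeasureProjMeasure (P : Measure (EuclideanSpace ℝ (Fin m)))
    [IsProbabilityMeasure P] (B : Matrix (Fin q) (Fin m) ℝ) :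
    IsProbabilityMeasure (projMeasure P B) :=
  isProbabilityMeasure_projMeasure P B

variable (q m) in
/-- The truncated dispersion of any projection of any law is controlled by the truncated dispersions
of its projections to the coordinate planes of a fixed orthonormal basis. This replaces a moment
bound: moments of order `α > 1` alone do not make the halfspace dispersion finite if `q ≥ 2`. -/
lemma exists_lintegral_min_halfspaceDepth_le [NeZero q] [NeZero m] :
    ∃ C : ℝ≥0∞, C ≠ ∞ ∧ ∀ O ∈ frames m m, ∀ B ∈ frames q m,
      ∀ (ν : Measure (EuclideanSpace ℝ (Fin m))) [IsProbabilityMeasure ν] (ε : ℝ≥0∞),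
        ∫⁻ y, min (halfspaceDepth (projMeasure ν B) y) ε ≤
          C * ∑ f : Fin q ↪ Fin m,
            ∫⁻ y, min (halfspaceDepth (projMeasure ν (O.submatrix f id)) y) ε := by
  obtain ⟨C, hC, hvol⟩ := exists_volume_image_le q m
  set M : ℝ≥0∞ := ((m + 1 : ℕ) : ℝ≥0∞) with hM
  have hM0 : M ≠ 0 := by simp [hM]
  have hMt : M ≠ ∞ := ENNReal.natCast_ne_top _
  have hM1 : 1 ≤ M := by rw [hM]; exact_mod_cast Nat.le_add_left 1 m
  refine ⟨C * M, ENNReal.mul_ne_top hC hMt, ?_⟩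
  intro O hO B hB ν _ ε
  have hmeas : ∀ A : Matrix (Fin q) (Fin m) ℝ,
      Measurable fun y => min (halfspaceDepth (projMeasure ν A) y) ε := fun A =>
    (measurable_halfspaceDepth _).min measurable_const
  have hfin : ∀ (A : Matrix (Fin q) (Fin m) ℝ) y,
      min (halfspaceDepth (projMeasure ν A) y) ε ≠ ∞ := fun A y =>
    ne_top_of_le_ne_top ENNReal.one_ne_top ((min_le_left _ _).trans (halfspaceDepth_le_one _ _))
  set g : (Fin q ↪ Fin m) → EuclideanSpace ℝ (Fin q) → ℝ≥0∞ := fun f y =>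
    M * min (halfspaceDepth (projMeasure ν (O.submatrix f id)) y) ε with hg
  have hgm : ∀ f, Measurable (g f) := fun f => (hmeas _).const_mul M
  have hlevel : ∀ t ∈ Set.Ioi (0 : ℝ),
      volume {y | ENNReal.ofReal t ≤ min (halfspaceDepth (projMeasure ν B) y) ε} ≤
        C * ∑ f, volume {y | ENNReal.ofReal t ≤ g f y} := by
    intro t ht
    set T := ENNReal.ofReal t with hT
    have hT0 : T ≠ 0 := (ENNReal.ofReal_pos.2 ht).ne'
    rcases lt_or_ge ε T with hε | hε
    · have : {y | T ≤ min (halfspaceDepth (projMeasure ν B) y) ε} = ∅ :=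
        Set.eq_empty_of_forall_notMem fun y hy =>
          (not_le.2 hε) (le_trans (show T ≤ min _ ε from hy) (min_le_right _ _))
      rw [this, measure_empty]
      exact bot_le
    set K := {x | T / M ≤ halfspaceDepth ν x}
    calc volume {y | T ≤ min (halfspaceDepth (projMeasure ν B) y) ε}
        ≤ volume (Matrix.toEuclideanLin B '' K) := by
          refine measure_mono fun y hy => ?_
          exact le_halfspaceDepth_projMeasure_subset_image ν B hT0
            (le_trans (show T ≤ min _ ε from hy) (min_le_left _ _))
      _ ≤ C * ∑ f : Fin q ↪ Fin m,
            volume (Matrix.toEuclideanLin (O.submatrix f id) '' K) :=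
          hvol O hO B hB K (convex_le_halfspaceDepth ν _)
            (isCompact_le_halfspaceDepth ν (ENNReal.div_ne_zero.2 ⟨hT0, hMt⟩))
      _ ≤ _ := by
          gcongr with f
          intro y hy
          have h1 : T / M ≤ halfspaceDepth (projMeasure ν (O.submatrix f id)) y :=
            image_le_halfspaceDepth_subset ν (submatrix_mem_frames hO f) _ hy
          have h2 : T ≤ M * halfspaceDepth (projMeasure ν (O.submatrix f id)) y := by
            rw [ENNReal.div_le_iff hM0 hMt] at h1
            rwa [mul_comm]
          change T ≤ M * min _ ε
          rw [mul_min]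
          exact le_min h2 (hε.trans (le_mul_of_one_le_left bot_le hM1))
  calc ∫⁻ y, min (halfspaceDepth (projMeasure ν B) y) ε
      = ∫⁻ t in Set.Ioi (0 : ℝ),
          volume {y | ENNReal.ofReal t ≤ min (halfspaceDepth (projMeasure ν B) y) ε} :=
        lintegral_eq_lintegral_measure_ofReal_le (hmeas B) (hfin B)
    _ ≤ ∫⁻ t in Set.Ioi (0 : ℝ), C * ∑ f, volume {y | ENNReal.ofReal t ≤ g f y} :=
        setLIntegral_mono' measurableSet_Ioi hlevel
    _ = C * ∑ f, ∫⁻ t in Set.Ioi (0 : ℝ), volume {y | ENNReal.ofReal t ≤ g f y} := by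
        rw [lintegral_const_mul' _ _ hC, lintegral_finsetSum]
        intro f _
        refine Antitone.measurable fun s t hst => measure_mono fun y hy => ?_
        exact (ENNReal.ofReal_le_ofReal hst).trans (show ENNReal.ofReal t ≤ g f y from hy)
    _ = C * ∑ f : Fin q ↪ Fin m,
          M * ∫⁻ y, min (halfspaceDepth (projMeasure ν (O.submatrix f id)) y) ε := by
        congr 1
        refine Finset.sum_congr rfl fun f _ => ?_
        rw [← lintegral_eq_lintegral_measure_ofReal_le (hgm f)
          fun y => ENNReal.mul_ne_top hMt (hfin _ y), lintegral_const_mul _ (hmeas _)]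
    _ = _ := by rw [← Finset.mul_sum, mul_assoc]

/-- Fatou's lemma for the halfspace dispersion. -/
lemma dispersion_halfspace_le_liminf {ν : ℕ → ProbabilityMeasure (EuclideanSpace ℝ (Fin m))}
    {P : ProbabilityMeasure (EuclideanSpace ℝ (Fin m))} (hν : Tendsto ν atTop (𝓝 P))
    (hP : P.toMeasure ≪ volume) {B : ℕ → Matrix (Fin q) (Fin m) ℝ}
    {B₀ : Matrix (Fin q) (Fin m) ℝ} (hB : Tendsto B atTop (𝓝 B₀)) (hB₀ : B₀ ∈ frames q m) :
    dispersion .halfspace (projMeasure P.toMeasure B₀) ≤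
      liminf (fun n => dispersion .halfspace (projMeasure (ν n).toMeasure (B n))) atTop := by
  refine le_trans (le_of_eq (lintegral_congr fun y => ?_))
    (lintegral_liminf_le fun n => measurable_halfspaceDepth (projMeasure (ν n).toMeasure (B n)))
  exact (tendsto_halfspaceDepth hν hP hB hB₀ y).liminf_eq.symm

/-- Upper semicontinuity of the halfspace dispersion, once the dispersions of the projections to the
coordinate planes of some orthonormal basis are finite and converge. -/
lemma limsup_dispersion_halfspace_le [NeZero q] [NeZero m]
    {ν : ℕ → ProbabilityMeasure (EuclideanSpace ℝ (Fin m))}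
    {P : ProbabilityMeasure (EuclideanSpace ℝ (Fin m))} (hν : Tendsto ν atTop (𝓝 P))
    (hP : P.toMeasure ≪ volume) {B : ℕ → Matrix (Fin q) (Fin m) ℝ} (hBf : ∀ n, B n ∈ frames q m)
    {B₀ : Matrix (Fin q) (Fin m) ℝ} (hB : Tendsto B atTop (𝓝 B₀)) (hB₀ : B₀ ∈ frames q m)
    {O : Matrix (Fin m) (Fin m) ℝ} (hO : O ∈ frames m m)
    (hfin : ∀ f : Fin q ↪ Fin m,
      dispersion .halfspace (projMeasure P.toMeasure (O.submatrix f id)) ≠ ∞)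
    (hlim : ∀ f : Fin q ↪ Fin m, Tendsto
      (fun n => dispersion .halfspace (projMeasure (ν n).toMeasure (O.submatrix f id))) atTop
      (𝓝 (dispersion .halfspace (projMeasure P.toMeasure (O.submatrix f id))))) :
    limsup (fun n => dispersion .halfspace (projMeasure (ν n).toMeasure (B n))) atTop ≤
      dispersion .halfspace (projMeasure P.toMeasure B₀) := by
  obtain ⟨C, hC, hdom⟩ := exists_lintegral_min_halfspaceDepth_le q m
  have hmeas : ∀ (ν : ProbabilityMeasure (EuclideanSpace ℝ (Fin m)))
      (A : Matrix (Fin q) (Fin m) ℝ), Measurable (halfspaceDepth (projMeasure ν.toMeasure A)) :=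
    fun ν A => measurable_halfspaceDepth _
  set d := halfspaceDepth (projMeasure P.toMeasure B₀)
  set df : (Fin q ↪ Fin m) → EuclideanSpace ℝ (Fin q) → ℝ≥0∞ := fun f =>
    halfspaceDepth (projMeasure P.toMeasure (O.submatrix f id))
  have hε : ∀ ε : ℝ≥0∞, ε ≠ 0 → ε ≠ ∞ →
      limsup (fun n => dispersion .halfspace (projMeasure (ν n).toMeasure (B n))) atTop ≤
        (C * ∑ f, ∫⁻ y, min (df f y) ε) + ∫⁻ y, d y := by
    intro ε hε hεt
    have h1 : Tendsto (fun n => C * ∑ f : Fin q ↪ Fin m, ∫⁻ y,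
        min (halfspaceDepth (projMeasure (ν n).toMeasure (O.submatrix f id)) y) ε) atTop
        (𝓝 (C * ∑ f, ∫⁻ y, min (df f y) ε)) := by
      refine ENNReal.Tendsto.const_mul (tendsto_finsetSum _ fun f _ => ?_) (Or.inr hC)
      exact tendsto_lintegral_min (fun n => hmeas _ _) (hmeas _ _)
        (fun y => tendsto_halfspaceDepth hν hP tendsto_const_nhds (submatrix_mem_frames hO f) y)
        (hfin f) (hlim f) ε
    have h2 : Tendsto (fun n => ∫⁻ y, (halfspaceDepth (projMeasure (ν n).toMeasure (B n)) y - ε))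
        atTop (𝓝 (∫⁻ y, (d y - ε))) := by
      obtain ⟨R, hR⟩ := exists_ball_halfspaceDepth_lt hν hBf hε
      refine tendsto_lintegral_filter_of_dominated_convergence
        ((Metric.ball (0 : EuclideanSpace ℝ (Fin q)) R).indicator 1)
        (Eventually.of_forall fun n => (hmeas _ _).sub measurable_const) ?_ ?_ ?_
      · filter_upwards [hR] with n hn
        refine Eventually.of_forall fun y => ?_
        by_cases hy : y ∈ Metric.ball (0 : EuclideanSpace ℝ (Fin q)) R
        · rw [Set.indicator_of_mem hy]
          exact tsub_le_self.trans (halfspaceDepth_le_one _ _)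
        · have hy' : R ≤ ‖y‖ := by simpa using hy
          rw [tsub_eq_zero_of_le (hn y hy').le]
          exact bot_le
      · rw [lintegral_indicator_one measurableSet_ball]
        exact measure_ball_lt_top.ne
      · exact Eventually.of_forall fun y => ENNReal.Tendsto.sub
          (tendsto_halfspaceDepth hν hP hB hB₀ y) tendsto_const_nhds (Or.inr hεt)
    calc limsup (fun n => dispersion .halfspace (projMeasure (ν n).toMeasure (B n))) atTop
        ≤ limsup (fun n => (C * ∑ f : Fin q ↪ Fin m, ∫⁻ y,
            min (halfspaceDepth (projMeasure (ν n).toMeasure (O.submatrix f id)) y) ε) +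
            ∫⁻ y, (halfspaceDepth (projMeasure (ν n).toMeasure (B n)) y - ε)) atTop := by
          refine limsup_le_limsup (Eventually.of_forall fun n => ?_)
          change ∫⁻ y, halfspaceDepth (projMeasure (ν n).toMeasure (B n)) y ≤ _
          rw [lintegral_eq_lintegral_min_add (hmeas _ _) ε]
          exact add_le_add (hdom O hO (B n) (hBf n) (ν n).toMeasure ε) le_rfl
      _ = (C * ∑ f, ∫⁻ y, min (df f y) ε) + ∫⁻ y, (d y - ε) := (h1.add h2).limsup_eq
      _ ≤ _ := by gcongr; exact tsub_le_self
  have h0 : Tendsto (fun n : ℕ => (C * ∑ f, ∫⁻ y, min (df f y) ((n : ℝ≥0∞)⁻¹)) + ∫⁻ y, d y) atTop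
      (𝓝 ((C * ∑ _f : Fin q ↪ Fin m, 0) + ∫⁻ y, d y)) :=
    (ENNReal.Tendsto.const_mul (tendsto_finsetSum _ fun f _ =>
      tendsto_lintegral_min_zero (hmeas _ _) (hfin f)) (Or.inr hC)).add tendsto_const_nhds
  rw [Finset.sum_const_zero, mul_zero, zero_add] at h0
  refine ge_of_tendsto h0 ?_
  filter_upwards [eventually_gt_atTop 0] with n hn
  exact hε _ (ENNReal.inv_ne_zero.2 (ENNReal.natCast_ne_top n))
    (ENNReal.inv_ne_top.2 (by exact_mod_cast hn.ne'))

/-- If `q < m`, some orthonormal basis of `ℝᵐ` has no `q` members that span the row space of `B`.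
It suffices that one member be neither in this row space nor orthogonal to it. -/
lemma exists_frame_rowProj_submatrix_ne (hq : 0 < q) (hqm : q < m)
    {B : Matrix (Fin q) (Fin m) ℝ} (hB : B ∈ frames q m) :
    ∃ O ∈ frames m m, ∀ f : Fin q ↪ Fin m, rowProj (O.submatrix f id) ≠ rowProj B := by
  have : NeZero q := ⟨hq.ne'⟩
  have : NeZero m := ⟨(hq.trans hqm).ne'⟩
  obtain ⟨b, hb, hb0⟩ := Submodule.exists_mem_ne_zero_of_ne_bot
    (LinearMap.ker_ne_bot_of_finrank_lt (f := Matrix.toEuclideanLin B) (by simpa using hqm))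
  have hb : Matrix.toEuclideanLin B b = 0 := hb
  set e : EuclideanSpace ℝ (Fin q) := EuclideanSpace.single 0 1
  set a := Matrix.toEuclideanLin B.transpose e
  have hBab : Matrix.toEuclideanLin B (a + b) = e := by
    rw [map_add, hb, add_zero, toEuclideanLin_transpose_apply hB]
  have hab : inner ℝ a b = 0 := by rw [← inner_toEuclideanLin, hb, inner_zero_right]
  have hnorm : ‖a + b‖ ^ 2 = 1 + ‖b‖ ^ 2 := by
    rw [norm_add_sq_real, hab, norm_toEuclideanLin_transpose hB]
    simp [e]
  have hbpos : 0 < ‖b‖ := norm_pos_iff.2 hb0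
  have hne : ‖a + b‖ ≠ 0 := by
    intro h
    rw [h] at hnorm
    nlinarith
  set o := ‖a + b‖⁻¹ • (a + b) with ho
  have ho1 : ‖o‖ = 1 := by rw [ho, norm_smul, norm_inv, norm_norm, inv_mul_cancel₀ hne]
  have hBo : ‖Matrix.toEuclideanLin B o‖ ^ 2 = (1 + ‖b‖ ^ 2)⁻¹ := by
    rw [ho, map_smul, hBab, norm_smul, mul_pow, norm_inv, norm_norm, inv_pow, hnorm]
    simp [e]
  obtain ⟨v, hv⟩ := Orthonormal.exists_orthonormalBasis_extension_of_card_eq (𝕜 := ℝ)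
    (E := EuclideanSpace ℝ (Fin m)) (ι := Fin m) (by simp) (v := fun _ => o) (s := {0}) (by
      refine ⟨fun i => ho1, fun i j hij => absurd (Subsingleton.elim i j) hij⟩)
  have hv0 : v 0 = o := hv 0 rfl
  set O : Matrix (Fin m) (Fin m) ℝ := Matrix.of fun i j => v i j with hO
  have hOO : O * O.transpose = 1 := by
    ext i j
    have := (orthonormal_iff_ite.1 v.orthonormal) j i
    rw [EuclideanSpace.inner_eq_star_dotProduct] at this
    simp only [star_trivial, dotProduct] at this
    rw [Matrix.mul_apply, Matrix.one_apply]
    simp only [hO, Matrix.transpose_apply, Matrix.of_apply, this, eq_comm]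
  refine ⟨O, hOO, fun f hf => ?_⟩
  have hnormsq : ∀ A : Matrix (Fin q) (Fin m) ℝ, ‖Matrix.toEuclideanLin A o‖ ^ 2 =
      inner ℝ (Matrix.toEuclideanLin (rowProj A) o) o := by
    intro A
    rw [← real_inner_self_eq_norm_sq, inner_toEuclideanLin]
    simp only [rowProj, Matrix.toLpLin_apply, Matrix.mulVec_mulVec]
  have hval : ‖Matrix.toEuclideanLin (O.submatrix f id) o‖ ^ 2 =
      ∑ i, (if f i = 0 then (1 : ℝ) else 0) := by
    rw [EuclideanSpace.norm_sq_eq]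
    refine Finset.sum_congr rfl fun i _ => ?_
    have : Matrix.toEuclideanLin (O.submatrix f id) o i = (O * O.transpose) (f i) 0 := by
      simp [Matrix.toLpLin_apply, Matrix.mul_apply, Matrix.mulVec, dotProduct, hO, hv0]
    rw [this, hOO, Matrix.one_apply]
    split_ifs <;> simp
  have heq : (1 + ‖b‖ ^ 2)⁻¹ = ∑ i, (if f i = 0 then (1 : ℝ) else 0) := by
    rw [← hval, ← hBo, hnormsq, hnormsq, hf]
  have hlt : (1 + ‖b‖ ^ 2)⁻¹ < 1 := inv_lt_one_of_one_lt₀ (by nlinarith)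
  have hpos : 0 < (1 + ‖b‖ ^ 2)⁻¹ := by positivity
  rw [heq, Finset.sum_boole] at hlt hpos
  have h1 : 0 < (Finset.univ.filter fun i => f i = 0).card := by exact_mod_cast hpos
  have h2 : (Finset.univ.filter fun i => f i = 0).card < 1 := by exact_mod_cast hlt
  omega

end HalfspaceDispersion

/-! ### The law of large numbers for the halfspace dispersion of a fixed projection -/

section FixedProjection

variable {Ω : Type*} [MeasurableSpace Ω] {μ : Measure Ω} {q m : ℕ}
  {P : Measure (EuclideanSpace ℝ (Fin m))} [IsProbabilityMeasure P]
  {X : ℕ → Ω → EuclideanSpace ℝ (Fin m)}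

lemma measurable_measure_halfspace {k : ℕ} (Q : Measure (EuclideanSpace ℝ (Fin k)))
    (u : EuclideanSpace ℝ (Fin k)) : Measurable fun y => Q (halfspace y u) := by
  have hmono : Monotone fun c : ℝ => Q {z | inner ℝ u z ≤ c} := fun c c' h =>
    measure_mono fun z hz => le_trans (show inner ℝ u z ≤ c from hz) h
  exact hmono.measurable.comp (by fun_prop : Measurable fun y => inner ℝ u y)

/-- The halfspace dispersion of a fixed projection is dominated by a linear functional of the law
that almost attains it at `P`: replace the halfspaces of minimal mass by measurably chosen
halfspaces whose mass is almost minimal under `P`. -/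
lemma exists_dispersion_halfspace_le_lintegral [NeZero q] (hP : P ≪ volume)
    {B : Matrix (Fin q) (Fin m) ℝ} (hB : B ∈ frames q m) {δ : ℝ≥0∞} (hδ : δ ≠ 0) :
    ∃ g : EuclideanSpace ℝ (Fin m) → ℝ≥0∞, Measurable g ∧
      (∀ (ν : Measure (EuclideanSpace ℝ (Fin m))) [IsProbabilityMeasure ν],
        dispersion .halfspace (projMeasure ν B) ≤ ∫⁻ x, g x ∂ν) ∧
      ∫⁻ x, g x ∂P ≤ dispersion .halfspace (projMeasure P B) + δ := by
  obtain ⟨e, he0, hem, heδ⟩ := exists_pos_lintegral_lt_of_sigmaFinite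
    (volume : Measure (EuclideanSpace ℝ (Fin q))) hδ
  set Q := projMeasure P B with hQ
  set S := Metric.sphere (0 : EuclideanSpace ℝ (Fin q)) 1
  have hSne : Nonempty S := ⟨⟨EuclideanSpace.single 0 1, by simp [S]⟩⟩
  set u : ℕ → S := TopologicalSpace.denseSeq S
  have hcont : ∀ y, Continuous fun v : S => Q (halfspace y v) := by
    intro y
    rw [continuous_iff_continuousAt]
    intro v
    have hv : ‖(v : EuclideanSpace ℝ (Fin q))‖ = 1 := by simp
    simp only [ContinuousAt, hQ, projMeasure_halfspace]
    refine tendsto_measure_halfspace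
      (ν := fun _ => (⟨P, inferInstance⟩ : ProbabilityMeasure (EuclideanSpace ℝ (Fin m))))
      (P := ⟨P, inferInstance⟩)
      (a := fun v : S => Matrix.toEuclideanLin B.transpose v) tendsto_const_nhds hP ?_ ?_ ?_
    · exact tendsto_toEuclideanLin tendsto_const_nhds (continuous_subtype_val.tendsto v)
    · rw [← norm_ne_zero_iff, norm_toEuclideanLin_transpose hB, hv]; exact one_ne_zero
    · exact (continuous_subtype_val.tendsto v).inner tendsto_const_nhds
  have hex : ∀ y, ∃ j, Q (halfspace y (u j)) < halfspaceDepth Q y + e y := by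
    intro y
    have hlt : halfspaceDepth Q y < halfspaceDepth Q y + e y :=
      ENNReal.lt_add_right (ne_top_of_le_ne_top ENNReal.one_ne_top (halfspaceDepth_le_one Q y))
        (by simpa using (he0 y).ne')
    obtain ⟨v, hv, hvlt⟩ : ∃ v : EuclideanSpace ℝ (Fin q), ‖v‖ = 1 ∧
        Q (halfspace y v) < halfspaceDepth Q y + e y := by
      by_contra! h
      exact hlt.not_ge (le_halfspaceDepth_iff.2 h)
    have hopen : IsOpen {v : S | Q (halfspace y v) < halfspaceDepth Q y + e y} :=
      isOpen_lt (hcont y) continuous_const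
    obtain ⟨j, hj⟩ := (TopologicalSpace.denseRange_denseSeq S).exists_mem_open hopen
      ⟨⟨v, by simpa [S] using hv⟩, hvlt⟩
    exact ⟨j, hj⟩
  classical
  set J : EuclideanSpace ℝ (Fin q) → ℕ := fun y => Nat.find (hex y)
  have hJ : Measurable J := measurable_find hex fun j =>
    measurableSet_lt (measurable_measure_halfspace Q _)
      ((measurable_halfspaceDepth Q).add hem.coe_nnreal_ennreal)
  have huJ : Measurable fun y => (u (J y) : EuclideanSpace ℝ (Fin q)) :=
    (measurable_from_nat (f := fun j => (u j : EuclideanSpace ℝ (Fin q)))).comp hJ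
  set T : Set (EuclideanSpace ℝ (Fin m) × EuclideanSpace ℝ (Fin q)) :=
    {p | inner ℝ (u (J p.2) : EuclideanSpace ℝ (Fin q)) (Matrix.toEuclideanLin B p.1) ≤
      inner ℝ (u (J p.2) : EuclideanSpace ℝ (Fin q)) p.2} with hT
  have hTm : MeasurableSet T := by
    refine measurableSet_le ?_ ?_
    · exact (huJ.comp measurable_snd).inner ((measurable_toEuclideanLin B).comp measurable_fst)
    · exact (huJ.comp measurable_snd).inner measurable_snd
  have hint : ∀ (ν : Measure (EuclideanSpace ℝ (Fin m))) [IsProbabilityMeasure ν],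
      ∫⁻ x, volume (Prod.mk x ⁻¹' T) ∂ν =
        ∫⁻ y, projMeasure ν B (halfspace y (u (J y))) := by
    intro ν _
    rw [← Measure.prod_apply hTm, Measure.prod_apply_symm hTm]
    refine lintegral_congr fun y => ?_
    rw [projMeasure, Measure.map_apply (measurable_toEuclideanLin B)
      (isClosed_halfspace _ _).measurableSet]
    rfl
  refine ⟨fun x => volume (Prod.mk x ⁻¹' T), measurable_measure_prodMk_left hTm, ?_, ?_⟩
  · intro ν _
    rw [hint]
    refine lintegral_mono fun y => ?_
    exact le_halfspaceDepth_iff.1 le_rfl _ (by simp)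
  · rw [hint]
    calc ∫⁻ y, Q (halfspace y (u (J y))) ≤ ∫⁻ y, (halfspaceDepth Q y + e y) :=
          lintegral_mono fun y => (Nat.find_spec (hex y)).le
      _ = dispersion .halfspace Q + ∫⁻ y, (e y : ℝ≥0∞) :=
          lintegral_add_left (measurable_halfspaceDepth Q) _
      _ ≤ _ := by gcongr

/-- The strong law of large numbers for the halfspace dispersion of a fixed projection, under the
sole assumption that its limit is finite. -/
lemma ae_tendsto_dispersion_halfspace [NeZero q] (hP : P ≪ volume)
    (hlaw : ∀ i, HasLaw (X i) P μ) (hind : iIndepFun X μ)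
    {B : Matrix (Fin q) (Fin m) ℝ} (hB : B ∈ frames q m)
    (hfin : dispersion .halfspace (projMeasure P B) ≠ ∞) :
    ∀ᵐ ω ∂μ, Tendsto (fun n => dispersion .halfspace
      (projMeasure (empiricalProb (fun i => X i ω) n).toMeasure B)) atTop
      (𝓝 (dispersion .halfspace (projMeasure P B))) := by
  have hδ : ∀ k : ℕ, ∀ᵐ ω ∂μ, limsup (fun n => dispersion .halfspace
      (projMeasure (empiricalProb (fun i => X i ω) n).toMeasure B)) atTop ≤
      dispersion .halfspace (projMeasure P B) + (k : ℝ≥0∞)⁻¹ := by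
    intro k
    rcases Nat.eq_zero_or_pos k with rfl | hk
    · simp
    obtain ⟨g, hgm, hgν, hgP⟩ := exists_dispersion_halfspace_le_lintegral hP hB
      (ENNReal.inv_ne_zero.2 (ENNReal.natCast_ne_top k))
    have hgi : ∫⁻ x, g x ∂P ≠ ∞ := ne_top_of_le_ne_top (ENNReal.add_ne_top.2
      ⟨hfin, ENNReal.inv_ne_top.2 (by exact_mod_cast hk.ne')⟩) hgP
    filter_upwards [ae_tendsto_lintegral_empirical hlaw hind hgm hgi] with ω hω
    refine le_trans ?_ hgP
    rw [← hω.limsup_eq]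
    exact limsup_le_limsup (Eventually.of_forall fun n => hgν _)
  filter_upwards [ae_all_iff.2 hδ, ae_tendsto_empiricalProb hlaw hind] with ω h1 h2
  refine tendsto_of_le_liminf_of_limsup_le
    (dispersion_halfspace_le_liminf h2 hP tendsto_const_nhds hB) ?_
  have h0 := (tendsto_const_nhds (x := dispersion .halfspace (projMeasure P B))).add
    ENNReal.tendsto_inv_nat_nhds_zero
  rw [add_zero] at h0
  exact ge_of_tendsto' h0 h1

end FixedProjection

/-! ### Dispersion with respect to simplicial depth -/

section UniformIntegrability

variable {Z : Type*} [MeasurableSpace Z] [TopologicalSpace Z] [OpensMeasurableSpace Z]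

lemma nnreal_sub_le_rpow_mul_rpow {a : ℝ} (ha : 1 ≤ a) (x : NNReal) {M : NNReal} (hM : 0 < M) :
    x - M ≤ x ^ a * M ^ (1 - a) := by
  rcases le_total x M with h | h
  · rw [tsub_eq_zero_of_le h]; exact bot_le
  · have hx : 0 < x := hM.trans_le h
    calc x - M ≤ x := tsub_le_self
      _ = x ^ a * x ^ (1 - a) := by
          rw [← NNReal.rpow_add hx.ne', add_sub_cancel, NNReal.rpow_one]
      _ ≤ x ^ a * M ^ (1 - a) :=
          mul_le_mul' le_rfl (NNReal.rpow_le_rpow_of_nonpos hM h (by linarith))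

/-- Weak convergence and a uniform bound on the moments of order `a > 1` of a continuous function
imply convergence of its integrals. -/
lemma tendsto_lintegral_of_moment_le {ν : ℕ → ProbabilityMeasure Z} {P : ProbabilityMeasure Z}
    [HasOuterApproxClosed Z] (hν : Tendsto ν atTop (𝓝 P)) {h : Z → NNReal} (hc : Continuous h)
    {a : ℝ} (ha : 1 < a) {C : ℝ≥0∞} (hC : C ≠ ∞)
    (hmom : ∀ᶠ n in atTop, ∫⁻ z, ((h z ^ a : NNReal) : ℝ≥0∞) ∂(ν n).toMeasure ≤ C) :
    Tendsto (fun n => ∫⁻ z, (h z : ℝ≥0∞) ∂(ν n).toMeasure) atTop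
      (𝓝 (∫⁻ z, (h z : ℝ≥0∞) ∂P.toMeasure)) := by
  refine tendsto_of_le_liminf_of_limsup_le ?_ ?_
  · have := lintegral_le_liminf_lintegral_of_forall_isOpen_measure_le_liminf_measure
      (μ := P.toMeasure) (μs := fun n => (ν n).toMeasure) (f := fun z => (h z : ℝ))
      (NNReal.continuous_coe.comp hc) (fun z => (h z).2)
      (fun G hG => ProbabilityMeasure.le_liminf_measure_open_of_tendsto hν hG)
    simpa only [ENNReal.ofReal_coe_nnreal] using this
  · have hM : ∀ M : NNReal, 0 < M → limsup (fun n => ∫⁻ z, (h z : ℝ≥0∞) ∂(ν n).toMeasure) atTop ≤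
        ∫⁻ z, (h z : ℝ≥0∞) ∂P.toMeasure + C * ((M ^ (1 - a) : NNReal) : ℝ≥0∞) := by
      intro M hM
      set b : BoundedContinuousFunction Z NNReal := BoundedContinuousFunction.mkOfBound
        ⟨fun z => min (h z) M, hc.min continuous_const⟩ M (fun x y => by
          rw [NNReal.dist_eq, abs_sub_le_iff]
          have hx : ((min (h x) M : NNReal) : ℝ) ≤ M := by exact_mod_cast min_le_right _ _
          have hy : ((min (h y) M : NNReal) : ℝ) ≤ M := by exact_mod_cast min_le_right _ _
          have hx0 : (0 : ℝ) ≤ (min (h x) M : NNReal) := NNReal.coe_nonneg _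
          have hy0 : (0 : ℝ) ≤ (min (h y) M : NNReal) := NNReal.coe_nonneg _
          simp only [ContinuousMap.coe_mk]
          exact ⟨by linarith, by linarith⟩) with hb
      have hbv : ∀ z, b z = min (h z) M := fun z => rfl
      have h1 := (ProbabilityMeasure.tendsto_iff_forall_lintegral_tendsto.1 hν b).add
        (tendsto_const_nhds (x := C * ((M ^ (1 - a) : NNReal) : ℝ≥0∞)))
      calc limsup (fun n => ∫⁻ z, (h z : ℝ≥0∞) ∂(ν n).toMeasure) atTop
          ≤ limsup (fun n => ∫⁻ z, (b z : ℝ≥0∞) ∂(ν n).toMeasure +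
              C * ((M ^ (1 - a) : NNReal) : ℝ≥0∞)) atTop := by
            refine limsup_le_limsup ?_
            filter_upwards [hmom] with n hn
            calc ∫⁻ z, (h z : ℝ≥0∞) ∂(ν n).toMeasure
                ≤ ∫⁻ z, ((b z : ℝ≥0∞) + ((h z ^ a : NNReal) : ℝ≥0∞) *
                    ((M ^ (1 - a) : NNReal) : ℝ≥0∞)) ∂(ν n).toMeasure := by
                  refine lintegral_mono fun z => ?_
                  rw [hbv, ← ENNReal.coe_mul, ← ENNReal.coe_add, ENNReal.coe_le_coe]
                  calc h z = min (h z) M + (h z - M) := by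
                        rcases le_total (h z) M with h' | h'
                        · rw [min_eq_left h', tsub_eq_zero_of_le h', add_zero]
                        · rw [min_eq_right h', add_tsub_cancel_of_le h']
                    _ ≤ _ := by
                        gcongr
                        exact nnreal_sub_le_rpow_mul_rpow ha.le _ hM
              _ = ∫⁻ z, (b z : ℝ≥0∞) ∂(ν n).toMeasure +
                    (∫⁻ z, ((h z ^ a : NNReal) : ℝ≥0∞) ∂(ν n).toMeasure) *
                    ((M ^ (1 - a) : NNReal) : ℝ≥0∞) := by
                  rw [lintegral_add_left b.continuous.measurable.coe_nnreal_ennreal,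
                    lintegral_mul_const' _ _ ENNReal.coe_ne_top]
              _ ≤ _ := by gcongr
        _ = ∫⁻ z, (b z : ℝ≥0∞) ∂P.toMeasure + C * ((M ^ (1 - a) : NNReal) : ℝ≥0∞) :=
            h1.limsup_eq
        _ ≤ _ := by
            gcongr with z
            rw [hbv]
            exact min_le_left _ _
    have h0 : Tendsto (fun k : ℕ => ∫⁻ z, (h z : ℝ≥0∞) ∂P.toMeasure +
        C * ((((k : NNReal) + 1) ^ (1 - a) : NNReal) : ℝ≥0∞)) atTop
        (𝓝 (∫⁻ z, (h z : ℝ≥0∞) ∂P.toMeasure + C * ((0 : NNReal) : ℝ≥0∞))) := by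
      refine tendsto_const_nhds.add (ENNReal.Tendsto.const_mul (ENNReal.tendsto_coe.2 ?_)
        (Or.inr hC))
      rw [← NNReal.tendsto_coe]
      simp only [NNReal.coe_rpow, NNReal.coe_add, NNReal.coe_natCast, NNReal.coe_one,
        NNReal.coe_zero]
      have := (tendsto_rpow_neg_atTop (y := a - 1) (by linarith)).comp
        (tendsto_atTop_add_const_right _ (1 : ℝ) (tendsto_natCast_atTop_atTop (R := ℝ)))
      simpa [Function.comp_def] using this
    rw [ENNReal.coe_zero, mul_zero, add_zero] at h0
    exact ge_of_tendsto' h0 fun k => hM _ (by positivity)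

end UniformIntegrability

section SimplicialDispersion

variable {q m : ℕ}

lemma isClosed_mem_convexHull_range {ι : Type*} [Fintype ι] (E : Type*) [NormedAddCommGroup E]
    [NormedSpace ℝ E] : IsClosed {p : (ι → E) × E | p.2 ∈ convexHull ℝ (Set.range p.1)} := by
  classical
  have hmem : ∀ p : (ι → E) × E, p.2 ∈ convexHull ℝ (Set.range p.1) ↔
      ∃ w : stdSimplex ℝ ι, ∑ i, w.1 i • p.1 i = p.2 := by
    rintro ⟨v, x⟩
    have h : Set.range v = Fintype.linearCombination ℝ v '' Set.range fun i => Pi.single i 1 := by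
      rw [← Set.range_comp]
      congr 1
      ext i
      simp
    simp only
    rw [h, ← LinearMap.image_convexHull, convexHull_rangle_single_eq_stdSimplex]
    simp [Fintype.linearCombination_apply]
  have h : {p : (ι → E) × E | p.2 ∈ convexHull ℝ (Set.range p.1)} =
      Prod.fst '' {r : ((ι → E) × E) × stdSimplex ℝ ι | ∑ i, r.2.1 i • r.1.1 i = r.1.2} := by
    ext p
    simp only [Set.mem_ofPred_eq, hmem, Set.mem_image, Prod.exists, exists_and_right,
      exists_eq_right]
  rw [h]
  refine isClosedMap_fst_of_compactSpace _ (isClosed_eq ?_ (by fun_prop))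
  refine continuous_finsetSum _ fun i _ => ?_
  have : Continuous fun r : ((ι → E) × E) × stdSimplex ℝ ι => r.2.1 i :=
    (continuous_apply i).comp (continuous_subtype_val.comp continuous_snd)
  fun_prop

/-- The simplicial dispersion is the mean volume of the random simplex. -/
lemma dispersion_simplicial_eq (Q : Measure (EuclideanSpace ℝ (Fin q))) [IsProbabilityMeasure Q] :
    dispersion .simplicial Q = volume (convexHull ℝ (Set.range (cornerVertex q))) *
      ∫⁻ w, (‖(edgeMatrix w).det‖₊ : ℝ≥0∞) ∂Measure.pi (fun _ : Fin (q + 1) => Q) := by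
  have hT := (isClosed_mem_convexHull_range (ι := Fin (q + 1))
    (EuclideanSpace ℝ (Fin q))).measurableSet
  have h1 := Measure.prod_apply (μ := Measure.pi fun _ : Fin (q + 1) => Q) (ν := volume) hT
  rw [Measure.prod_apply_symm hT] at h1
  change ∫⁻ x, Measure.pi (fun _ : Fin (q + 1) => Q) {v | x ∈ convexHull ℝ (Set.range v)} = _
  refine h1.trans ?_
  rw [← lintegral_const_mul' _ _ volume_cornerSimplex_ne_top]
  refine lintegral_congr fun w => ?_
  change volume (convexHull ℝ (Set.range w)) = _
  rw [volume_convexHull_range, mul_comm, ← Real.norm_eq_abs, ofReal_norm]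
  rfl

/-- The determinant of the edges is affine in each vertex. This is why moments of order more than
`1` suffice for the simplicial depth in any dimension. -/
lemma abs_det_edgeMatrix_le_prod (w : Fin (q + 1) → EuclideanSpace ℝ (Fin q)) :
    |(edgeMatrix w).det| ≤ (q + 1).factorial * ∏ i, (1 + ‖w i‖) := by
  set N : Matrix (Fin (q + 1)) (Fin (q + 1)) ℝ :=
    Matrix.of fun i => Fin.cons 1 fun l => w i l with hN
  set N' : Matrix (Fin (q + 1)) (Fin (q + 1)) ℝ := Matrix.of fun i j =>
    N i j + (Fin.cons 0 fun _ => -1 : Fin (q + 1) → ℝ) i * N 0 j with hN'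
  have h1 : N'.det = N.det := Matrix.det_eq_of_forall_row_eq_smul_add_const _ 0
    (by simp) (fun i j => rfl)
  have h2 : N'.det = (edgeMatrix w).det := by
    rw [Matrix.det_succ_column_zero, Fin.sum_univ_succ, Finset.sum_eq_zero, ← Matrix.det_transpose]
    · simp only [hN', hN, Fin.val_zero, pow_zero, Matrix.of_apply, Fin.cons_zero]
      rw [add_zero]
      norm_num
      congr 1
      ext i l
      simp [edgeMatrix, sub_eq_add_neg]
    · intro i _
      simp [hN', hN]
  have h3 : ∀ i j, |N i j| ≤ 1 + ‖w i‖ := by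
    intro i j
    refine Fin.cases ?_ (fun l => ?_) j
    · simp [hN]
    · simp only [hN, Matrix.of_apply, Fin.cons_succ]
      have := PiLp.norm_apply_le (w i) l
      rw [Real.norm_eq_abs] at this
      linarith
  rw [← h2, h1, Matrix.det_apply']
  calc |∑ σ : Equiv.Perm (Fin (q + 1)), ((Equiv.Perm.sign σ : ℤ) : ℝ) * ∏ i, N (σ i) i|
      ≤ ∑ σ : Equiv.Perm (Fin (q + 1)), ∏ i, (1 + ‖w i‖) := by
        refine (Finset.abs_sum_le_sum_abs _ _).trans (Finset.sum_le_sum fun σ _ => ?_)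
        have hs : |((Equiv.Perm.sign σ : ℤ) : ℝ)| = 1 := by
          rcases Int.units_eq_one_or (Equiv.Perm.sign σ) with h | h <;> simp [h]
        rw [abs_mul, hs, one_mul, Finset.abs_prod, ← Equiv.prod_comp σ fun i => 1 + ‖w i‖]
        exact Finset.prod_le_prod (fun _ _ => abs_nonneg _) fun i _ => h3 _ _
    _ = _ := by
        rw [Finset.sum_const, Finset.card_univ, Fintype.card_perm, Fintype.card_fin, nsmul_eq_mul]

lemma lintegral_pi_prod {ι Z : Type*} [Fintype ι] [MeasurableSpace Z] (Q : Measure Z)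
    [IsProbabilityMeasure Q] {g : Z → ℝ≥0∞} (hg : Measurable g) :
    ∫⁻ w, ∏ i, g (w i) ∂Measure.pi (fun _ : ι => Q) = (∫⁻ z, g z ∂Q) ^ Fintype.card ι := by
  have hind := iIndepFun_pi (μ := fun _ : ι => Q) (X := fun _ => g)
    (fun _ => hg.aemeasurable)
  have h := lintegral_prod_eq_prod_lintegral_of_indepFun Finset.univ
    (fun (i : ι) (w : ι → Z) => g (w i)) hind (fun i => hg.comp (measurable_pi_apply i))
  rw [h]
  have : ∀ i : ι, ∫⁻ w, g (w i) ∂Measure.pi (fun _ : ι => Q) = ∫⁻ z, g z ∂Q := fun i =>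
    (measurePreserving_eval (fun _ : ι => Q) i).lintegral_comp hg
  simp [this]

/-- The projected law as a probability measure. -/
def projProb (P : ProbabilityMeasure (EuclideanSpace ℝ (Fin m))) (B : Matrix (Fin q) (Fin m) ℝ) :
    ProbabilityMeasure (EuclideanSpace ℝ (Fin q)) :=
  ⟨projMeasure P.toMeasure B, inferInstance⟩

/-- Projection is jointly continuous in the law and the matrix for weak convergence. -/
lemma tendsto_projMeasure {ν : ℕ → ProbabilityMeasure (EuclideanSpace ℝ (Fin m))}
    {P : ProbabilityMeasure (EuclideanSpace ℝ (Fin m))} (hν : Tendsto ν atTop (𝓝 P))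
    {B : ℕ → Matrix (Fin q) (Fin m) ℝ} {B₀ : Matrix (Fin q) (Fin m) ℝ}
    (hB : Tendsto B atTop (𝓝 B₀)) :
    Tendsto (fun n => projProb (ν n) (B n)) atTop (𝓝 (projProb P B₀)) := by
  have hF : Continuous fun p : (Fin q → Fin m → ℝ) × EuclideanSpace ℝ (Fin m) =>
      Matrix.toEuclideanLin (Matrix.of p.1) p.2 :=
    continuous_toEuclideanLin_apply (q := q) (m := m)
  have hB' : Tendsto (fun n => (Matrix.of.symm (B n) : Fin q → Fin m → ℝ)) atTop
      (𝓝 (Matrix.of.symm B₀)) := hB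
  have h1 : Tendsto (fun n => (diracProba (Matrix.of.symm (B n))).prod (ν n)) atTop
      (𝓝 ((diracProba (Matrix.of.symm B₀)).prod P)) :=
    (ProbabilityMeasure.continuous_prod.tendsto _).comp
      (((continuous_diracProba.tendsto _).comp hB').prodMk_nhds hν)
  have h2 := ProbabilityMeasure.tendsto_map_of_tendsto_of_continuous _ _ h1 hF
  have key : ∀ (A : Matrix (Fin q) (Fin m) ℝ)
      (ν : ProbabilityMeasure (EuclideanSpace ℝ (Fin m))),
      ((diracProba (Matrix.of.symm A)).prod ν).map hF.measurable.aemeasurable =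
        projProb ν A := by
    intro A ν
    apply Subtype.ext
    change Measure.map _ ((Measure.dirac (Matrix.of.symm A)).prod ν.toMeasure) =
      projMeasure ν.toMeasure A
    rw [Measure.dirac_prod, Measure.map_map hF.measurable (by fun_prop)]
    rfl
  simpa only [key] using h2

/-- Continuity of the simplicial dispersion along a weakly convergent sequence of laws with bounded
moments of order `a > 1`. -/
lemma tendsto_dispersion_simplicial {ν : ℕ → ProbabilityMeasure (EuclideanSpace ℝ (Fin m))}
    {P : ProbabilityMeasure (EuclideanSpace ℝ (Fin m))} (hν : Tendsto ν atTop (𝓝 P))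
    {B : ℕ → Matrix (Fin q) (Fin m) ℝ} (hBf : ∀ n, B n ∈ frames q m)
    {B₀ : Matrix (Fin q) (Fin m) ℝ} (hB : Tendsto B atTop (𝓝 B₀)) {a : ℝ} (ha : 1 < a)
    {C : ℝ≥0∞} (hC : C ≠ ∞)
    (hmom : ∀ᶠ n in atTop,
      ∫⁻ x, (((1 + ‖x‖₊) ^ a : NNReal) : ℝ≥0∞) ∂(ν n).toMeasure ≤ C) :
    Tendsto (fun n => dispersion .simplicial (projMeasure (ν n).toMeasure (B n))) atTop
      (𝓝 (dispersion .simplicial (projMeasure P.toMeasure B₀))) := by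
  simp only [dispersion_simplicial_eq]
  refine ENNReal.Tendsto.const_mul ?_ (Or.inr volume_cornerSimplex_ne_top)
  have hpi := (ProbabilityMeasure.continuous_pi (ι := Fin (q + 1))).tendsto _ |>.comp
    (tendsto_pi_nhds.2 fun _ : Fin (q + 1) => tendsto_projMeasure hν hB)
  have hcont : Continuous fun w : Fin (q + 1) → EuclideanSpace ℝ (Fin q) =>
      ‖(edgeMatrix w).det‖₊ := by
    refine (Continuous.matrix_det ?_).nnnorm
    exact continuous_matrix fun i l => by simp only [edgeMatrix, Matrix.of_apply]; fun_prop
  have hpow : Measurable fun x : EuclideanSpace ℝ (Fin q) =>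
      (((1 + ‖x‖₊) ^ a : NNReal) : ℝ≥0∞) := by fun_prop
  refine tendsto_lintegral_of_moment_le hpi hcont ha
    (C := (((q + 1).factorial ^ a : NNReal) : ℝ≥0∞) * C ^ (q + 1))
    (ENNReal.mul_ne_top ENNReal.coe_ne_top (ENNReal.pow_ne_top hC)) ?_
  filter_upwards [hmom] with n hn
  calc ∫⁻ w, ((‖(edgeMatrix w).det‖₊ ^ a : NNReal) : ℝ≥0∞)
        ∂Measure.pi (fun _ : Fin (q + 1) => projMeasure (ν n).toMeasure (B n))
      ≤ ∫⁻ w, (((q + 1).factorial ^ a : NNReal) : ℝ≥0∞) *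
          ∏ i, (((1 + ‖w i‖₊) ^ a : NNReal) : ℝ≥0∞)
        ∂Measure.pi (fun _ : Fin (q + 1) => projMeasure (ν n).toMeasure (B n)) := by
        refine lintegral_mono fun w => ?_
        have h1 : ‖(edgeMatrix w).det‖₊ ≤ (q + 1).factorial * ∏ i, (1 + ‖w i‖₊) := by
          rw [← NNReal.coe_le_coe]
          push_cast
          exact abs_det_edgeMatrix_le_prod w
        have h2 := NNReal.rpow_le_rpow h1 (zero_le_one.trans ha.le)
        rw [NNReal.mul_rpow, ← NNReal.finsetProd_rpow] at h2
        rw [← ENNReal.ofNNReal_finsetProd, ← ENNReal.coe_mul]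
        exact ENNReal.coe_le_coe.2 h2
    _ = (((q + 1).factorial ^ a : NNReal) : ℝ≥0∞) *
          (∫⁻ y, (((1 + ‖y‖₊) ^ a : NNReal) : ℝ≥0∞) ∂projMeasure (ν n).toMeasure (B n)) ^
            (q + 1) := by
        rw [lintegral_const_mul' _ _ ENNReal.coe_ne_top, lintegral_pi_prod _ hpow,
          Fintype.card_fin]
    _ ≤ _ := by
        gcongr
        refine le_trans ?_ hn
        rw [projMeasure, lintegral_map hpow (measurable_toEuclideanLin _)]
        refine lintegral_mono fun x => ENNReal.coe_le_coe.2 ?_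
        refine NNReal.rpow_le_rpow ?_ (zero_le_one.trans ha.le)
        gcongr
        exact norm_toEuclideanLin_le (hBf n) x

lemma lintegral_one_add_norm_rpow_ne_top {P : Measure (EuclideanSpace ℝ (Fin m))}
    [IsProbabilityMeasure P] {a : ℝ} (ha : 1 < a) (h : Integrable (fun x => ‖x‖ ^ a) P) :
    ∫⁻ x, (((1 + ‖x‖₊) ^ a : NNReal) : ℝ≥0∞) ∂P ≠ ∞ := by
  have h1 : ∫⁻ x, ((‖x‖₊ ^ a : NNReal) : ℝ≥0∞) ∂P < ∞ := by
    refine lt_of_le_of_lt (lintegral_mono fun x => ?_) h.2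
    refine le_of_eq ?_
    rw [← ofReal_norm, Real.norm_of_nonneg (Real.rpow_nonneg (norm_nonneg _) _),
      ← ENNReal.ofReal_coe_nnreal, NNReal.coe_rpow, coe_nnnorm]
  refine ((lintegral_mono fun x => ENNReal.coe_le_coe.2
    (NNReal.rpow_add_le_mul_rpow_add_rpow 1 ‖x‖₊ ha.le)).trans_lt ?_).ne
  simp only [NNReal.one_rpow, ENNReal.coe_mul, ENNReal.coe_add, ENNReal.coe_one]
  rw [lintegral_const_mul' _ _ ENNReal.coe_ne_top, lintegral_add_left measurable_const,
    lintegral_const, measure_univ, mul_one]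
  exact ENNReal.mul_lt_top ENNReal.coe_lt_top (ENNReal.add_lt_top.2 ⟨ENNReal.one_lt_top, h1⟩)

end SimplicialDispersion

/-! ### Convergence of the optimal subspaces -/

section Consistency

variable {q m : ℕ}

lemma subspaceTendsto_of_isMaximizer {φ : ℕ → Matrix (Fin q) (Fin m) ℝ → ℝ≥0∞}
    {φ₀ : Matrix (Fin q) (Fin m) ℝ → ℝ≥0∞} {Bs : ℕ → Matrix (Fin q) (Fin m) ℝ}
    {B : Matrix (Fin q) (Fin m) ℝ} (hB : IsUniqueMaximizer φ₀ B)
    (hBs : ∀ n ≥ 1, IsMaximizer (φ n) (Bs n))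
    (hlow : ∀ ψ : ℕ → ℕ, Tendsto ψ atTop atTop →
      φ₀ B ≤ liminf (fun k => φ (ψ k + 1) B) atTop)
    (hup : ∀ ψ : ℕ → ℕ, Tendsto ψ atTop atTop → ∀ C ∈ frames q m, rowProj C ≠ rowProj B →
      Tendsto (fun k => Bs (ψ k + 1)) atTop (𝓝 C) →
      limsup (fun k => φ (ψ k + 1) (Bs (ψ k + 1))) atTop ≤ φ₀ C) :
    SubspaceTendsto Bs B := by
  refine subspaceTendsto_of_forall_limit hB.1 (fun n hn => (hBs n hn).1) fun ψ hψ C hC hlim => ?_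
  by_contra hne
  refine (hB.2 C hC hne).not_ge ?_
  calc φ₀ B ≤ liminf (fun k => φ (ψ k + 1) B) atTop := hlow ψ hψ
    _ ≤ limsup (fun k => φ (ψ k + 1) B) atTop := liminf_le_limsup
    _ ≤ limsup (fun k => φ (ψ k + 1) (Bs (ψ k + 1))) atTop :=
        limsup_le_limsup (Eventually.of_forall fun k => (hBs _ (by omega)).2 B hB.1)
    _ ≤ φ₀ C := hup ψ hψ C hC hne hlim

lemma subspaceTendsto_of_isMinimizer {φ : ℕ → Matrix (Fin q) (Fin m) ℝ → ℝ≥0∞}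
    {φ₀ : Matrix (Fin q) (Fin m) ℝ → ℝ≥0∞} {Bs : ℕ → Matrix (Fin q) (Fin m) ℝ}
    {B : Matrix (Fin q) (Fin m) ℝ} (hB : IsUniqueMinimizer φ₀ B)
    (hBs : ∀ n ≥ 1, IsMinimizer (φ n) (Bs n))
    (hlow : ∀ ψ : ℕ → ℕ, Tendsto ψ atTop atTop → ∀ C ∈ frames q m,
      Tendsto (fun k => Bs (ψ k + 1)) atTop (𝓝 C) →
      φ₀ C ≤ liminf (fun k => φ (ψ k + 1) (Bs (ψ k + 1))) atTop)
    (hup : φ₀ B ≠ ∞ → ∀ ψ : ℕ → ℕ, Tendsto ψ atTop atTop →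
      limsup (fun k => φ (ψ k + 1) B) atTop ≤ φ₀ B) :
    SubspaceTendsto Bs B := by
  refine subspaceTendsto_of_forall_limit hB.1 (fun n hn => (hBs n hn).1) fun ψ hψ C hC hlim => ?_
  by_contra hne
  have hlt := hB.2 C hC hne
  refine hlt.not_ge ?_
  calc φ₀ C ≤ liminf (fun k => φ (ψ k + 1) (Bs (ψ k + 1))) atTop := hlow ψ hψ C hC hlim
    _ ≤ limsup (fun k => φ (ψ k + 1) (Bs (ψ k + 1))) atTop := liminf_le_limsup
    _ ≤ limsup (fun k => φ (ψ k + 1) B) atTop :=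
        limsup_le_limsup (Eventually.of_forall fun k => (hBs _ (by omega)).2 B hB.1)
    _ ≤ φ₀ B := hup (ne_top_of_lt hlt) ψ hψ

lemma rowProj_eq_one_of_mem_frames {O : Matrix (Fin m) (Fin m) ℝ} (hO : O ∈ frames m m) :
    rowProj O = 1 :=
  transpose_mul_self_of_mem_frames hO

variable {Ω : Type*} [MeasurableSpace Ω] {μ : Measure Ω}
  {P : Measure (EuclideanSpace ℝ (Fin m))} [IsProbabilityMeasure P]
  {X : ℕ → Ω → EuclideanSpace ℝ (Fin m)}

/-- If some subspace uniquely maximizes the halfspace dispersion, then the empirical dispersions are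
almost surely upper semicontinuous. The coordinate planes of a basis in general position to the
maximizer serve as the reference: their dispersions are less than the maximum, hence finite. -/
lemma ae_limsup_dispersion_halfspace_le [NeZero q] [NeZero m] (hqm : q < m) (hP : P ≪ volume)
    (hlaw : ∀ i, HasLaw (X i) P μ) (hind : iIndepFun X μ) {B : Matrix (Fin q) (Fin m) ℝ}
    (hB : IsUniqueMaximizer (fun B => dispersion .halfspace (projMeasure P B)) B) :
    ∀ᵐ ω ∂μ, ∀ ψ : ℕ → ℕ, Tendsto ψ atTop atTop →
      ∀ A : ℕ → Matrix (Fin q) (Fin m) ℝ, (∀ k, A k ∈ frames q m) →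
      ∀ C ∈ frames q m, Tendsto A atTop (𝓝 C) →
        limsup (fun k => dispersion .halfspace
          (projMeasure (empirical (fun i => X i ω) (ψ k + 1)) (A k))) atTop ≤
        dispersion .halfspace (projMeasure P C) := by
  obtain ⟨O, hO, hOB⟩ := exists_frame_rowProj_submatrix_ne (NeZero.pos q) hqm hB.1
  have hfin : ∀ f : Fin q ↪ Fin m,
      dispersion .halfspace (projMeasure P (O.submatrix f id)) ≠ ∞ := fun f =>
    ne_top_of_lt (hB.2 _ (submatrix_mem_frames hO f) (hOB f))
  have hlim : ∀ᵐ ω ∂μ, ∀ f : Fin q ↪ Fin m, Tendsto (fun n => dispersion .halfspace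
      (projMeasure (empiricalProb (fun i => X i ω) n).toMeasure (O.submatrix f id))) atTop
      (𝓝 (dispersion .halfspace (projMeasure P (O.submatrix f id)))) :=
    ae_all_iff.2 fun f =>
      ae_tendsto_dispersion_halfspace hP hlaw hind (submatrix_mem_frames hO f) (hfin f)
  filter_upwards [hlim, ae_tendsto_empiricalProb hlaw hind] with ω h1 h2 ψ hψ A hA C hC hAC
  exact limsup_dispersion_halfspace_le
    (ν := fun k => empiricalProb (fun i => X i ω) (ψ k)) (P := ⟨P, inferInstance⟩)
    (h2.comp hψ) hP hA hAC hC hO hfin fun f => (h1 f).comp hψ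

lemma ae_tendsto_dispersion_simplicial (hlaw : ∀ i, HasLaw (X i) P μ) (hind : iIndepFun X μ)
    {a : ℝ} (ha : 1 < a) (hmom : Integrable (fun x => ‖x‖ ^ a) P) :
    ∀ᵐ ω ∂μ, ∀ ψ : ℕ → ℕ, Tendsto ψ atTop atTop →
      ∀ A : ℕ → Matrix (Fin q) (Fin m) ℝ, (∀ k, A k ∈ frames q m) →
      ∀ C : Matrix (Fin q) (Fin m) ℝ, Tendsto A atTop (𝓝 C) →
        Tendsto (fun k => dispersion .simplicial
          (projMeasure (empirical (fun i => X i ω) (ψ k + 1)) (A k))) atTop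
          (𝓝 (dispersion .simplicial (projMeasure P C))) := by
  have hfin := lintegral_one_add_norm_rpow_ne_top ha hmom
  filter_upwards [ae_tendsto_empiricalProb hlaw hind, ae_tendsto_lintegral_empirical hlaw hind
    (f := fun x => (((1 + ‖x‖₊) ^ a : NNReal) : ℝ≥0∞)) (by fun_prop) hfin] with
    ω h1 h2 ψ hψ A hA C hAC
  have hev := (h2.comp hψ).eventually_le_const (ENNReal.lt_add_right hfin one_ne_zero)
  exact tendsto_dispersion_simplicial
    (ν := fun k => empiricalProb (fun i => X i ω) (ψ k)) (P := ⟨P, inferInstance⟩)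
    (h1.comp hψ) hA hAC ha (ENNReal.add_ne_top.2 ⟨hfin, ENNReal.one_ne_top⟩) hev

end Consistency

end DepthDispersion

end

open DepthDispersion

theorem mainTheorem2
    {Ω : Type*} [MeasurableSpace Ω] (μ : Measure Ω) [IsProbabilityMeasure μ]
    (q m : ℕ) (hq : 1 ≤ q) (hqm : q ≤ m)
    (P : Measure (EuclideanSpace ℝ (Fin m))) [IsProbabilityMeasure P]
    (hP : P ≪ volume)
    (α : ℝ) (hα : 1 < α) (hmom : Integrable (fun x => ‖x‖ ^ α) P)
    (X : ℕ → Ω → EuclideanSpace ℝ (Fin m))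
    (hlaw : ∀ i, HasLaw (X i) P μ) (hind : iIndepFun X μ)
    (L : DepthDispersion.DepthKind)
    (Bstar : Matrix (Fin q) (Fin m) ℝ)
    (Bhat : ℕ → Ω → Matrix (Fin q) (Fin m) ℝ) :
    (DepthDispersion.IsUniqueMaximizer
        (fun B => DepthDispersion.dispersion L (DepthDispersion.projMeasure P B)) Bstar →
      (∀ᵐ ω ∂μ, ∀ n ≥ 1, DepthDispersion.IsMaximizer
        (fun B => DepthDispersion.dispersion L
          (DepthDispersion.projMeasure
            (DepthDispersion.empirical (fun i => X i ω) n) B)) (Bhat n ω)) →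
      ∀ᵐ ω ∂μ, DepthDispersion.SubspaceTendsto (fun n => Bhat n ω) Bstar) ∧
    (DepthDispersion.IsUniqueMinimizer
        (fun B => DepthDispersion.dispersion L (DepthDispersion.projMeasure P B)) Bstar →
      (∀ᵐ ω ∂μ, ∀ n ≥ 1, DepthDispersion.IsMinimizer
        (fun B => DepthDispersion.dispersion L
          (DepthDispersion.projMeasure
            (DepthDispersion.empirical (fun i => X i ω) n) B)) (Bhat n ω)) →
      ∀ᵐ ω ∂μ, DepthDispersion.SubspaceTendsto (fun n => Bhat n ω) Bstar) := by
  have : NeZero q := ⟨by omega⟩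
  have : NeZero m := ⟨by omega⟩
  constructor
  · intro hB hmax
    cases L with
    | halfspace =>
      have hup : ∀ᵐ ω ∂μ, ∀ ψ : ℕ → ℕ, Tendsto ψ atTop atTop →
          ∀ A : ℕ → Matrix (Fin q) (Fin m) ℝ, (∀ k, A k ∈ frames q m) →
          ∀ C ∈ frames q m, rowProj C ≠ rowProj Bstar → Tendsto A atTop (𝓝 C) →
            limsup (fun k => dispersion .halfspace
              (projMeasure (empirical (fun i => X i ω) (ψ k + 1)) (A k))) atTop ≤
            dispersion .halfspace (projMeasure P C) := by
        rcases hqm.lt_or_eq with hlt | rfl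
        · filter_upwards [ae_limsup_dispersion_halfspace_le hlt hP hlaw hind hB] with
            ω h ψ hψ A hA C hC _ hAC
          exact h ψ hψ A hA C hC hAC
        · -- there is only one subspace if `q = m`
          refine Eventually.of_forall fun ω ψ _ A _ C hC hne => absurd ?_ hne
          rw [rowProj_eq_one_of_mem_frames hC, rowProj_eq_one_of_mem_frames hB.1]
      filter_upwards [hmax, hup, ae_tendsto_empiricalProb hlaw hind] with ω h1 h2 h3
      refine subspaceTendsto_of_isMaximizer hB h1 (fun ψ hψ => ?_)
        fun ψ hψ C hC hne hlim =>
          h2 ψ hψ (fun k => Bhat (ψ k + 1) ω) (fun k => (h1 _ (by omega)).1) C hC hne hlim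
      exact dispersion_halfspace_le_liminf
        (ν := fun k => empiricalProb (fun i => X i ω) (ψ k)) (P := ⟨P, inferInstance⟩)
        (h3.comp hψ) hP tendsto_const_nhds hB.1
    | simplicial =>
      filter_upwards [hmax, ae_tendsto_dispersion_simplicial (q := q) hlaw hind hα hmom] with
        ω h1 h2
      exact subspaceTendsto_of_isMaximizer hB h1
        (fun ψ hψ => (h2 ψ hψ (fun _ => Bstar) (fun _ => hB.1) _
          tendsto_const_nhds).liminf_eq.ge)
        fun ψ hψ C hC _ hlim => (h2 ψ hψ (fun k => Bhat (ψ k + 1) ω)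
          (fun k => (h1 _ (by omega)).1) C hlim).limsup_eq.le
  · intro hB hmin
    cases L with
    | halfspace =>
      have hup : ∀ᵐ ω ∂μ, dispersion .halfspace (projMeasure P Bstar) ≠ ∞ →
          Tendsto (fun n => dispersion .halfspace
            (projMeasure (empiricalProb (fun i => X i ω) n).toMeasure Bstar)) atTop
            (𝓝 (dispersion .halfspace (projMeasure P Bstar))) := by
        by_cases hfin : dispersion .halfspace (projMeasure P Bstar) = ∞
        · exact Eventually.of_forall fun ω h => absurd hfin h
        · filter_upwards [ae_tendsto_dispersion_halfspace hP hlaw hind hB.1 hfin] with ω h _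
          exact h
      filter_upwards [hmin, hup, ae_tendsto_empiricalProb hlaw hind] with ω h1 h2 h3
      refine subspaceTendsto_of_isMinimizer hB h1 (fun ψ hψ C hC hlim => ?_)
        fun hfin ψ hψ => ((h2 hfin).comp hψ).limsup_eq.le
      exact dispersion_halfspace_le_liminf
        (ν := fun k => empiricalProb (fun i => X i ω) (ψ k)) (P := ⟨P, inferInstance⟩)
        (h3.comp hψ) hP hlim hC
    | simplicial =>
      filter_upwards [hmin, ae_tendsto_dispersion_simplicial (q := q) hlaw hind hα hmom] with
        ω h1 h2
      exact subspaceTendsto_of_isMinimizer hB h1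
        (fun ψ hψ C hC hlim => (h2 ψ hψ (fun k => Bhat (ψ k + 1) ω)
          (fun k => (h1 _ (by omega)).1) C hlim).liminf_eq.ge)
        fun _ ψ hψ => (h2 ψ hψ (fun _ => Bstar) (fun _ => hB.1) _
          tendsto_const_nhds).limsup_eq.le
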